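/- All graphs are finite and simple. The degree sequence of a graph is the list of the degrees of all its vertices in non-increasing order, and the graph is called a realization of that sequence. A graph is self-complementary if it is isomorphic to its complement. A degree sequence (that is, a sequence with at least one realization) is forcibly self-complementary if all of its realizations are self-complementary. Write $(d_i^{n_i})_{i=1}^{\ell}$ with $d_1 > d_2 > \cdots > d_\ell$ and all $n_i \ge 1$ for the sequence consisting of $n_1$ copies of $d_1$, followed by $n_2$ copies of $d_2$, and so on up to $n_\ell$ copies of $d_\ell$, and let $n = \sum_{i=1}^{\ell} n_i$. Theorem (Rao's characterization). A degree sequence $(d_i^{n_i})_{i=1}^{\ell}$ is forcibly self-complementary if and only if (1) for all $i = 1, \dots, \lfloor \ell/2 \rfloor$, $$n_{\ell+1-i} = n_i \in \{2, 4\} \quad\text{and}\quad d_{\ell+1-i} = n - 1 - d_i = \sum_{j=1}^{i} n_j - \tfrac{1}{2} n_i;$$ and (2) if $\ell$ is odd, then $n_{(\ell+1)/2} \in \{1, 5\}$ and $d_{(\ell+1)/2} = \tfrac{1}{2}(n-1)$. -/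

import Mathlib

/-- The degree sequence of a finite simple graph: the degrees of all its vertices, listed in
non-increasing order. -/
noncomputable def degreeSequence {V : Type} [Fintype V] (G : SimpleGraph V) : List ℕ :=
  open Classical in (Finset.univ.val.map fun v : V => G.degree v).sort (· ≥ ·)

/-- `G` is isomorphic to its complement. -/
def IsSelfComplementary {V : Type} (G : SimpleGraph V) : Prop :=
  Nonempty (G ≃g Gᶜ)

/-- `τ` is a degree sequence, i.e. it is the degree sequence of some finite simple graph. -/
def IsDegreeSequence (τ : List ℕ) : Prop :=
  ∃ (V : Type) (_ : Fintype V) (G : SimpleGraph V), degreeSequence G = τ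

/-- All realizations of `τ` are self-complementary. -/
def IsForciblySelfComplementary (τ : List ℕ) : Prop :=
  ∀ (V : Type) [Fintype V] (G : SimpleGraph V), degreeSequence G = τ → IsSelfComplementary G

/-- The sequence `(d₁^{n₁}, …, d_ℓ^{n_ℓ})`: `n 1` copies of `d 1`, followed by `n 2` copies of
`d 2`, and so on up to `n ℓ` copies of `d ℓ`. Values at indices outside `1, …, ℓ` play no role. -/
def compactSequence (ℓ : ℕ) (d n : ℕ → ℕ) : List ℕ :=
  (List.range' 1 ℓ).flatMap fun i => List.replicate (n i) (d i)

/-! A self-complementary graph on N vertices has an antimorphism, a permutation exchanging edges and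
non-edges. It sends degree δ to N - 1 - δ, so it swaps the class A of largest degree with the class
B of smallest degree, and exactly half of the A-B pairs are edges. Hence |A| = |B| = 2k, and if the
sequence is forced, every realization has 2k² edges between A and B. Degree-preserving switches
therefore cannot change this number (`Frame`). In a realization whose A-B edges form a k-regular
bipartite graph, this rigidity makes A complete to everything outside B or leaves B without
neighbours outside A (`Frame.top_complete_or_bottom_isolated`). Since the two extreme degrees add up
to N - 1, either alternative makes them N - 1 - k and k.

Conversely, these extreme degrees determine the shape of every realization (`extreme_classes`): A is
a clique, B is independent, the A-B edges form a k-regular bipartite graph R, and the graph H on the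
remaining vertices is completely joined to A and not at all to B. Here R can be any such bipartite
graph and H any realization of the shortened sequence. An antimorphism of the whole restricts to one
of H, and it acts on R by exchanging rows and columns with complementation. For k ≥ 3 the matrix
`twinColumns` has equal columns but no equal rows, so it admits no such exchange; for k ≤ 2 an
exhaustive check finds one for every R. Thus the sequence is forced iff k ∈ {1, 2} and the shortened
sequence is forced, and the numerical conditions obey the same recursion.

The recursion ends at the empty graph or at a regular graph of degree 2k on 4k + 1 vertices. There k
≥ 2 is excluded by `unbalancedRegular`, and k = 0, 1 leave a single vertex and the 5-cycle. -/

section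
open Finset Classical

variable {V : Type} [Fintype V]

/-! ### Neighbour counts and edge switches. -/

/-- The number of neighbours of `v` in `S`. -/
noncomputable def cnt {V : Type} (G : SimpleGraph V) (v : V) (S : Finset V) : ℕ :=
  #{u ∈ S | G.Adj v u}

theorem cnt_eq_sum {V : Type} (G : SimpleGraph V) (v : V) (S : Finset V) :
    (cnt G v S : ℤ) = ∑ u ∈ S, if G.Adj v u then 1 else 0 := by
  simp [cnt]

theorem cnt_univ (G : SimpleGraph V) (v : V) : cnt G v univ = G.degree v := by
  rw [← G.card_neighborFinset_eq_degree, G.neighborFinset_eq_filter, cnt]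

theorem cnt_add_cnt_compl (G : SimpleGraph V) (v : V) (S : Finset V) :
    cnt G v S + cnt G v Sᶜ = cnt G v univ := by
  unfold cnt
  rw [← card_union_of_disjoint (disjoint_filter_filter disjoint_compl_right),
    ← filter_union, union_compl]

theorem cnt_compl_graph {V : Type} (G : SimpleGraph V) (v : V) (S : Finset V) :
    cnt Gᶜ v S + cnt G v S + (if v ∈ S then 1 else 0) = #S := by
  have h1 : #{u ∈ S | v = u} = if v ∈ S then 1 else 0 := by
    rw [Finset.filter_eq]; split_ifs <;> simp
  rw [← h1]
  unfold cnt
  rw [← card_union_of_disjoint, ← card_union_of_disjoint]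
  · congr 1
    ext u
    simp only [SimpleGraph.compl_adj, mem_union, mem_filter]
    tauto
  · rw [Finset.disjoint_left]
    intro u hu hu'
    simp only [SimpleGraph.compl_adj, mem_union, mem_filter] at hu hu'
    rcases hu with hu | hu
    · exact hu.2.1 hu'.2
    · exact G.ne_of_adj hu.2 hu'.2
  · rw [Finset.disjoint_left]
    intro u hu hu'
    simp only [SimpleGraph.compl_adj, mem_filter] at hu hu'
    exact hu.2.2 hu'.2

theorem sum_cnt_comm {V : Type} (G : SimpleGraph V) (A B : Finset V) :
    ∑ b ∈ B, cnt G b A = ∑ a ∈ A, cnt G a B := by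
  zify
  simp only [cnt_eq_sum]
  rw [sum_comm]
  simp only [G.adj_comm]

/-- Exchanging the edges `ab`, `cd` for the edges `ac`, `bd`. -/
theorem exists_switch {V : Type} (G : SimpleGraph V) {a b c d : V} (hab : G.Adj a b)
    (hcd : G.Adj c d)
    (hac : ¬ G.Adj a c) (hbd : ¬ G.Adj b d) (nac : a ≠ c) (nbd : b ≠ d) :
    ∃ G' : SimpleGraph V,
      (∀ u v, G'.Adj u v ↔ (G.Adj u v ∧ s(u, v) ≠ s(a, b) ∧ s(u, v) ≠ s(c, d)) ∨
        s(u, v) = s(a, c) ∨ s(u, v) = s(b, d)) ∧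
      ∀ v S, (cnt G' v S : ℤ) = cnt G v S
        - (if v = a ∧ b ∈ S then 1 else 0) - (if v = b ∧ a ∈ S then 1 else 0)
        - (if v = c ∧ d ∈ S then 1 else 0) - (if v = d ∧ c ∈ S then 1 else 0)
        + (if v = a ∧ c ∈ S then 1 else 0) + (if v = c ∧ a ∈ S then 1 else 0)
        + (if v = b ∧ d ∈ S then 1 else 0) + (if v = d ∧ b ∈ S then 1 else 0) := by
  obtain ⟨G', hG⟩ : ∃ G' : SimpleGraph V, ∀ u v, G'.Adj u v ↔
      (G.Adj u v ∧ s(u, v) ≠ s(a, b) ∧ s(u, v) ≠ s(c, d)) ∨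
        s(u, v) = s(a, c) ∨ s(u, v) = s(b, d) := by
    refine ⟨{ Adj := fun u v => (G.Adj u v ∧ s(u, v) ≠ s(a, b) ∧ s(u, v) ≠ s(c, d)) ∨
                s(u, v) = s(a, c) ∨ s(u, v) = s(b, d)
              symm := ⟨fun u v h => by rw [G.adj_comm, Sym2.eq_swap]; exact h⟩
              loopless := ⟨fun u h => ?_⟩ }, fun _ _ => Iff.rfl⟩
    rcases h with h | h | h
    · exact G.loopless.irrefl u h.1
    · simp only [Sym2.eq_iff] at h; grind
    · simp only [Sym2.eq_iff] at h; grind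
  refine ⟨G', hG, fun v S => ?_⟩
  -- Identifying a with d, or b with c, would make ac an edge. So four distinct vertices are
  -- involved and the eight corrections do not interfere.
  have ad : a ≠ d := fun h => hac (h ▸ hcd.symm)
  have bc : b ≠ c := fun h => hac (h ▸ hab)
  have nab := hab.ne
  have ncd := hcd.ne
  have := ad.symm
  have := bc.symm
  have := nab.symm
  have := ncd.symm
  have := nac.symm
  have := nbd.symm
  have key : ∀ u, (if G'.Adj v u then 1 else 0 : ℤ) = (if G.Adj v u then 1 else 0)
      - (if u = b then if v = a then 1 else 0 else 0)
      - (if u = a then if v = b then 1 else 0 else 0)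
      - (if u = d then if v = c then 1 else 0 else 0)
      - (if u = c then if v = d then 1 else 0 else 0)
      + (if u = c then if v = a then 1 else 0 else 0)
      + (if u = a then if v = c then 1 else 0 else 0)
      + (if u = d then if v = b then 1 else 0 else 0)
      + (if u = b then if v = d then 1 else 0 else 0) := by
    intro u
    simp only [hG, Sym2.eq_iff, ne_eq]
    have := hab.symm
    have := hcd.symm
    have hca : ¬ G.Adj c a := fun h => hac h.symm
    have hdb : ¬ G.Adj d b := fun h => hbd h.symm
    by_cases va : v = a
    · subst va
      by_cases ub : u = b
      · subst ub; simp [*]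
      by_cases uc : u = c
      · subst uc; simp [*]
      simp [*]
    by_cases vb : v = b
    · subst vb
      by_cases ua : u = a
      · subst ua; simp [*]
      by_cases ud : u = d
      · subst ud; simp [*]
      simp [*]
    by_cases vc : v = c
    · subst vc
      by_cases ud : u = d
      · subst ud; simp [*]
      by_cases ua : u = a
      · subst ua; simp [*]
      simp [*]
    by_cases vd : v = d
    · subst vd
      by_cases uc : u = c
      · subst uc; simp [*]
      by_cases ub : u = b
      · subst ub; simp [*]
      simp [*]
    simp [*]
  rw [cnt_eq_sum, sum_congr rfl fun u _ => key u, cnt_eq_sum]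
  simp only [sum_add_distrib, sum_sub_distrib, Finset.sum_ite_eq', ite_and]
  simp only [← ite_and, and_comm]

/-! ### Rigidity of the edges between the extreme classes. -/

/-- `A` and `B` are the vertex classes of largest and smallest prescribed degree, both of size
`2k`, and all graphs with prescribed degrees `f` have the same number `2k²` of `A`-`B` edges. -/
structure Frame (f : V → ℕ) (A B : Finset V) (k : ℕ) : Prop where
  disj : Disjoint A B
  cardA : #A = 2 * k
  cardB : #B = 2 * k
  pos : 1 ≤ k
  lt_card : ∀ v, f v < Fintype.card V
  constA : ∀ a ∈ A, ∀ a' ∈ A, f a = f a'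
  constB : ∀ b ∈ B, ∀ b' ∈ B, f b = f b'
  topA : ∀ a ∈ A, ∀ v ∉ A, f v < f a
  botB : ∀ b ∈ B, ∀ v ∉ B, f b < f v
  edges : ∀ G : SimpleGraph V, (∀ v, cnt G v univ = f v) → ∑ b ∈ B, cnt G b A = 2 * k ^ 2

theorem cnt_univ_compl {f : V → ℕ} {G : SimpleGraph V} (hG : ∀ v, cnt G v univ = f v) (v : V) :
    cnt Gᶜ v univ = Fintype.card V - 1 - f v := by
  have := cnt_compl_graph G v univ
  simp only [mem_univ, if_true, card_univ, hG v] at this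
  omega

/-- Complementation exchanges the roles of A and B, and k is unchanged because 4k² - 2k² = 2k².
Every later statement thus has a dual. The field `lt_card` keeps the natural subtraction from
truncating. -/
theorem Frame.compl {f : V → ℕ} {A B : Finset V} {k : ℕ} (F : Frame f A B k) :
    Frame (fun v => Fintype.card V - 1 - f v) B A k where
  disj := F.disj.symm
  cardA := F.cardB
  cardB := F.cardA
  pos := F.pos
  lt_card v := by have := F.lt_card v; omega
  constA a ha a' ha' := by rw [F.constB a ha a' ha']
  constB a ha a' ha' := by rw [F.constA a ha a' ha']
  topA a ha v hv := by
    have := F.botB a ha v hv; have := F.lt_card v; omega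
  botB a ha v hv := by
    have := F.topA a ha v hv; have := F.lt_card a; omega
  edges G hG := by
    have h1 : ∀ v, cnt Gᶜ v univ = f v := fun v => by
      rw [cnt_univ_compl hG v]; have := F.lt_card v; omega
    have h2 := F.edges _ h1
    rw [sum_cnt_comm] at h2
    have h3 : ∑ a ∈ A, (cnt Gᶜ a B + cnt G a B) = ∑ a ∈ A, 2 * k := by
      refine sum_congr rfl fun a ha => ?_
      have := cnt_compl_graph G a B
      rw [if_neg (Finset.disjoint_left.1 F.disj ha), F.cardB] at this
      omega
    rw [sum_add_distrib, h2, sum_const, F.cardA, smul_eq_mul] at h3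
    nlinarith

theorem cnt_compl_of_notMem {V : Type} {G : SimpleGraph V} {v : V} {S : Finset V} (h : v ∉ S) :
    cnt Gᶜ v S = #S - cnt G v S := by
  have := cnt_compl_graph G v S
  rw [if_neg h] at this
  omega

/-- A switch that removes an `A`-`B` edge without restoring one is impossible. -/
theorem Frame.not_adj {f : V → ℕ} {A B : Finset V} {k : ℕ} (F : Frame f A B k)
    {G : SimpleGraph V} (hG : ∀ v, cnt G v univ = f v) {a b x y : V} (ha : a ∈ A) (hb : b ∈ B)
    (hab : G.Adj a b) (hx : x ∉ B) (hax : a ≠ x) (nax : ¬ G.Adj a x) (hy : y ∉ A) (hby : b ≠ y)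
    (nby : ¬ G.Adj b y) : ¬ G.Adj x y := by
  intro hxy
  obtain ⟨G', -, h'⟩ := exists_switch G hab hxy nax nby hax hby
  have hG' : ∀ v, cnt G' v univ = f v := by
    intro v
    have := h' v univ
    simp only [mem_univ, and_true] at this
    rw [← hG v]
    zify
    linarith
  -- The new edges ax and by are not A-B edges, since x ∉ B and y ∉ A. The deleted edge ab is one,
  -- and xy may be another, so the count drops by one or two.
  have e := F.edges G hG
  have e' := F.edges G' hG'
  have haB := Finset.disjoint_left.1 F.disj ha
  have hbA := Finset.disjoint_right.1 F.disj hb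
  zify at e e'
  simp only [h', ha, hbA, hy, and_true, and_false, if_false, sum_add_distrib, sum_sub_distrib,
    sum_const_zero] at e'
  rw [e] at e'
  simp only [ite_and, Finset.sum_ite_eq', hb, hx, haB, if_true, if_false] at e'
  split_ifs at e' <;> omega

theorem Frame.adj {f : V → ℕ} {A B : Finset V} {k : ℕ} (F : Frame f A B k)
    {G : SimpleGraph V} (hG : ∀ v, cnt G v univ = f v) {a b x y : V} (ha : a ∈ A) (hb : b ∈ B)
    (hab : ¬ G.Adj a b) (hx : x ∉ B) (nax : G.Adj a x) (hy : y ∉ A)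
    (nby : G.Adj b y) (hxy : x ≠ y) : G.Adj x y := by
  have hne : b ≠ a := fun h => Finset.disjoint_left.1 F.disj ha (h ▸ hb)
  have := F.compl.not_adj (cnt_univ_compl hG) (a := b) (b := a) (x := y) (y := x) hb ha
    (by rw [SimpleGraph.compl_adj, G.adj_comm]; exact ⟨hne, hab⟩) hy nby.ne
    (by simp [nby]) hx nax.ne (by simp [nax])
  rw [SimpleGraph.compl_adj, G.adj_comm] at this
  by_contra h
  exact this ⟨hxy.symm, h⟩

end

/-! ### Balancing the cross edges and the extreme position of the classes. -/

section
open Finset Classical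

variable {V : Type} [Fintype V]

/-- Pigeonhole, except that u itself must not serve as the witness. If u is a neighbour of v in S,
then `huv` makes v a neighbour of u in S, and removing one vertex from each neighbourhood keeps the
strict inequality. -/
theorem exists_private_neighbor {V : Type} {G : SimpleGraph V} {u v : V} {S : Finset V}
    (h : cnt G u S < cnt G v S) (huv : u ∈ S → G.Adj u v → v ∈ S) :
    ∃ y ∈ S, u ≠ y ∧ G.Adj v y ∧ ¬ G.Adj u y := by
  by_contra! hc
  have hsub : ({y ∈ S | G.Adj v y}).erase u ⊆ ({y ∈ S | G.Adj u y}).erase v := by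
    intro y hy
    simp only [mem_erase, mem_filter] at hy ⊢
    exact ⟨hy.2.2.ne', hy.2.1, hc y hy.2.1 (Ne.symm hy.1) hy.2.2⟩
  have hc' := card_le_card hsub
  unfold cnt at h
  by_cases hu : u ∈ S ∧ G.Adj v u
  · rw [card_erase_of_mem (by simpa using hu), card_erase_of_mem
      (by simpa using ⟨huv hu.1 hu.2.symm, hu.2.symm⟩)] at hc'
    have : 0 < #{y ∈ S | G.Adj u y} :=
      card_pos.2 ⟨v, by simpa using ⟨huv hu.1 hu.2.symm, hu.2.symm⟩⟩
    omega
  · rw [erase_eq_of_notMem (by simpa using hu)] at hc'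
    exact absurd (hc'.trans (card_le_card (erase_subset _ _))) (by omega)

theorem cnt_eq_zero_iff {V : Type} {G : SimpleGraph V} {v : V} {S : Finset V} :
    cnt G v S = 0 ↔ ∀ u ∈ S, ¬ G.Adj v u := by
  rw [cnt, card_eq_zero, filter_eq_empty_iff]

theorem exists_adj_of_cnt_pos {V : Type} {G : SimpleGraph V} {v : V} {S : Finset V}
    (h : 0 < cnt G v S) : ∃ u ∈ S, G.Adj v u := by
  obtain ⟨u, hu⟩ := card_pos.1 h
  exact ⟨u, by simpa using hu⟩

theorem exists_not_adj_of_cnt_lt {V : Type} {G : SimpleGraph V} {v : V} {S : Finset V}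
    (h : cnt G v S < #S) : ∃ u ∈ S, ¬ G.Adj v u := by
  by_contra! hc
  rw [cnt, filter_true_of_mem hc] at h
  exact lt_irrefl _ h

/-- The average of the counts over B is k, so an unbalanced graph has b above k and c below. A
switch hands an A-neighbour of b over to c. The B-counts of vertices of A do not change, so the
other side can be balanced afterwards in the complement. -/
theorem Frame.exists_regular_bottom {f : V → ℕ} {A B : Finset V} {k : ℕ} (F : Frame f A B k)
    (G : SimpleGraph V) (hG : ∀ v, cnt G v univ = f v) :
    ∃ G' : SimpleGraph V, (∀ v, cnt G' v univ = f v) ∧ (∀ b ∈ B, cnt G' b A = k) ∧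
      ∀ a ∈ A, cnt G' a B = cnt G a B := by
  induction hD : ∑ b ∈ B, (cnt G b A - k) using Nat.strong_induction_on generalizing G with
  | _ D ih =>
  have hsum : ∑ b ∈ B, cnt G b A = ∑ b ∈ B, k := by
    rw [F.edges G hG, sum_const, F.cardB, smul_eq_mul]; ring
  by_cases hle : ∀ b ∈ B, cnt G b A ≤ k
  · exact ⟨G, hG, (sum_eq_sum_iff_of_le hle).1 hsum, fun _ _ => rfl⟩
  push Not at hle
  obtain ⟨b, hb, hbk⟩ := hle
  obtain ⟨c, hc, hck⟩ : ∃ c ∈ B, cnt G c A < k := by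
    by_contra! hge
    exact absurd ((sum_eq_sum_iff_of_le hge).1 hsum.symm b hb) (by omega)
  have hbA := Finset.disjoint_right.1 F.disj hb
  have hcA := Finset.disjoint_right.1 F.disj hc
  obtain ⟨a, ha, hca, hba, nca⟩ := exists_private_neighbor (G := G) (u := c) (v := b) (S := A)
    (by omega) (fun h => absurd h hcA)
  have haB := Finset.disjoint_left.1 F.disj ha
  -- As b and c have equal degrees and c has fewer neighbours in A, it has more outside A.
  obtain ⟨y, hy, hby, hcy, nby⟩ := exists_private_neighbor (G := G) (u := b) (v := c) (S := Aᶜ)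
    (by
      have h1 := cnt_add_cnt_compl G b A
      have h2 := cnt_add_cnt_compl G c A
      rw [hG] at h1 h2
      have := F.constB b hb c hc
      omega) (fun _ _ => by simpa using hcA)
  rw [mem_compl] at hy
  obtain ⟨G', -, h'⟩ := exists_switch G hba.symm hcy (fun h => nca h.symm) nby hca.symm hby
  have hG' : ∀ v, cnt G' v univ = f v := by
    intro v
    have := h' v univ
    simp only [mem_univ, and_true] at this
    rw [← hG v]
    zify
    linarith
  have hBA : ∀ v ∈ B, (cnt G' v A : ℤ) =
      cnt G v A - (if v = b then 1 else 0) + (if v = c then 1 else 0) := by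
    intro v hv
    have : v ≠ a := fun h => haB (h ▸ hv)
    simp [h' v A, ha, hbA, hcA, hy]
  have hAB : ∀ v ∈ A, cnt G' v B = cnt G v B := by
    intro v hv
    have h1 : v ≠ b := fun h => hbA (h ▸ hv)
    have h2 : v ≠ c := fun h => hcA (h ▸ hv)
    have h3 : v ≠ y := fun h => hy (h ▸ hv)
    zify
    simp [h' v B, hb, hc, haB, h1, h2, h3]
  have hbc : b ≠ c := fun h => by rw [h] at hbk; omega
  -- The measure is the total excess over k, with truncated subtraction: it falls at b, and at c it
  -- stays zero because c was strictly below k.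
  obtain ⟨G'', g1, g2, g3⟩ := ih (∑ b ∈ B, (cnt G' b A - k)) (by
    rw [← hD]
    refine sum_lt_sum (fun v hv => ?_) ⟨b, hb, ?_⟩
    · have := hBA v hv
      by_cases hvc : v = c
      · subst hvc
        simp only [hbc.symm, if_true, if_false] at this
        omega
      · rw [if_neg hvc] at this
        split_ifs at this <;> omega
    · have := hBA b hb
      simp only [hbc, if_true, if_false] at this
      omega) G' hG' rfl
  exact ⟨G'', g1, g2, fun a ha => (g3 a ha).trans (hAB a ha)⟩

/-- The graph `G` has degrees `f`, and its `A`-`B` edges form a `k`-regular bipartite graph. -/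
structure BalancedGraph (f : V → ℕ) (A B : Finset V) (k : ℕ) (G : SimpleGraph V) : Prop where
  deg : ∀ v, cnt G v univ = f v
  bot : ∀ b ∈ B, cnt G b A = k
  top : ∀ a ∈ A, cnt G a B = k

theorem BalancedGraph.compl {f : V → ℕ} {A B : Finset V} {k : ℕ} {G : SimpleGraph V}
    (F : Frame f A B k) (h : BalancedGraph f A B k G) :
    BalancedGraph (fun v => Fintype.card V - 1 - f v) B A k Gᶜ where
  deg := cnt_univ_compl h.deg
  bot a ha := by
    rw [cnt_compl_of_notMem (Finset.disjoint_left.1 F.disj ha), h.top a ha, F.cardB]; omega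
  top a ha := by
    rw [cnt_compl_of_notMem (Finset.disjoint_right.1 F.disj ha), h.bot a ha, F.cardA]; omega

theorem Frame.exists_balanced {f : V → ℕ} {A B : Finset V} {k : ℕ} (F : Frame f A B k)
    (G : SimpleGraph V) (hG : ∀ v, cnt G v univ = f v) : ∃ G', BalancedGraph f A B k G' := by
  obtain ⟨G₁, h1, h2, -⟩ := F.exists_regular_bottom G hG
  obtain ⟨G₂, g1, g2, g3⟩ := F.compl.exists_regular_bottom G₁ᶜ (cnt_univ_compl h1)
  refine ⟨G₂ᶜ, ⟨fun v => ?_, fun b hb => ?_, fun a ha => ?_⟩⟩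
  · rw [cnt_univ_compl g1]
    have := F.lt_card v
    omega
  · have hbA := Finset.disjoint_right.1 F.disj hb
    rw [cnt_compl_of_notMem hbA, g3 b hb, cnt_compl_of_notMem hbA, h2 b hb, F.cardA]
    omega
  · rw [cnt_compl_of_notMem (Finset.disjoint_left.1 F.disj ha), g2 a ha, F.cardB]
    omega

/-- By rigidity x has no private neighbour outside A compared with b, so x has at most as many
neighbours there. But x ∉ B has larger degree than b, so the surplus lies in A, where b has k
neighbours. -/
theorem Frame.lt_cnt_of_private {f : V → ℕ} {A B : Finset V} {k : ℕ} (F : Frame f A B k)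
    {G : SimpleGraph V} (h : BalancedGraph f A B k G) {a b x : V} (ha : a ∈ A) (hb : b ∈ B)
    (hab : G.Adj a b) (hx : x ∉ B) (hax : a ≠ x) (nax : ¬ G.Adj a x)
    (hxb : x ∈ A → ¬ G.Adj b x) : k < cnt G x A := by
  have hle : cnt G x Aᶜ ≤ cnt G b Aᶜ := by
    by_contra! hlt
    obtain ⟨y, hy, hby, hxy, nby⟩ := exists_private_neighbor hlt
      (fun _ hbx => by rw [mem_compl]; exact fun hxA => hxb hxA hbx)
    exact F.not_adj h.deg ha hb hab hx hax nax (by simpa using hy) hby nby hxy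
  have h1 := cnt_add_cnt_compl G b A
  have h2 := cnt_add_cnt_compl G x A
  rw [h.deg] at h1 h2
  have := F.botB b hb x hx
  have := h.bot b hb
  omega

/-- This removes the last hypothesis of `Frame.lt_cnt_of_private`. The only obstruction is x ∈ A
with the same B-neighbours as a; a switch among the A-B edges then separates the two neighbourhoods.
-/
theorem Frame.lt_cnt_of_not_adj {f : V → ℕ} {A B : Finset V} {k : ℕ} (F : Frame f A B k)
    {G : SimpleGraph V} (h : BalancedGraph f A B k G) {a x : V} (ha : a ∈ A)
    (hx : x ∉ B) (hax : a ≠ x) (nax : ¬ G.Adj a x) : k < cnt G x A := by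
  have hk := F.pos
  by_cases hxA : x ∉ A
  · obtain ⟨b, hb, hab⟩ := exists_adj_of_cnt_pos (G := G) (v := a) (S := B)
      (by rw [h.top a ha]; omega)
    exact F.lt_cnt_of_private h ha hb hab hx hax nax (fun h => absurd h hxA)
  rw [not_not] at hxA
  by_cases hpriv : ∃ b ∈ B, G.Adj a b ∧ ¬ G.Adj b x
  · obtain ⟨b, hb, hab, hbx⟩ := hpriv
    exact F.lt_cnt_of_private h ha hb hab hx hax nax (fun _ => hbx)
  push Not at hpriv
  have haB := Finset.disjoint_left.1 F.disj ha
  obtain ⟨q, hq, haq⟩ := exists_not_adj_of_cnt_lt (G := G) (v := a) (S := B)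
    (by rw [h.top a ha, F.cardB]; omega)
  have hqA := Finset.disjoint_right.1 F.disj hq
  have hxq : ¬ G.Adj x q := by
    have hsub : ({b ∈ B | G.Adj a b}) ⊆ ({b ∈ B | G.Adj x b}) := by
      intro b hb
      simp only [mem_filter] at hb ⊢
      exact ⟨hb.1, (hpriv b hb.1 hb.2).symm⟩
    have := eq_of_subset_of_card_le hsub
      ((h.top x hxA).trans (h.top a ha).symm).le
    intro hxq
    have hmem : q ∈ ({b ∈ B | G.Adj x b}) := by simp [hq, hxq]
    rw [← this] at hmem
    exact haq (mem_filter.1 hmem).2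
  obtain ⟨c, hc, hqc⟩ := exists_adj_of_cnt_pos (G := G) (v := q) (S := A)
    (by rw [h.bot q hq]; omega)
  have hca : c ≠ a := fun e => haq (e ▸ hqc.symm)
  have hcx : c ≠ x := fun e => hxq (e ▸ hqc.symm)
  have hcB := Finset.disjoint_left.1 F.disj hc
  obtain ⟨p, hp, hap, hcp⟩ : ∃ p ∈ B, G.Adj a p ∧ ¬ G.Adj c p := by
    by_contra! hcon
    have hsub : ({b ∈ B | G.Adj a b}) ⊆ ({b ∈ B | G.Adj c b}) := by
      intro b hb
      simp only [mem_filter] at hb ⊢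
      exact ⟨hb.1, hcon b hb.1 hb.2⟩
    have := eq_of_subset_of_card_le hsub
      ((h.top c hc).trans (h.top a ha).symm).le
    have hmem : q ∈ ({b ∈ B | G.Adj c b}) := by simp [hq, hqc.symm]
    rw [← this] at hmem
    exact haq (mem_filter.1 hmem).2
  have hpA := Finset.disjoint_right.1 F.disj hp
  have hpx := hpriv p hp hap
  have hpq : p ≠ q := fun e => hxq (e ▸ hpx.symm)
  -- Replacing xp, qc by xq, pc keeps the graph balanced and does not alter the A-count of x, while
  -- p becomes adjacent to a but not to x.
  obtain ⟨G', hadj, h'⟩ := exists_switch G hpx.symm hqc hxq (fun e => hcp e.symm)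
    (fun e => hqA (e ▸ hxA)) (fun e => hpA (e ▸ hc))
  have hbal : BalancedGraph f A B k G' := by
    refine ⟨fun v => ?_, fun v hv => ?_, fun v hv => ?_⟩
    · have := h' v univ
      simp only [mem_univ, and_true] at this
      rw [← h.deg v]
      zify
      linarith
    · rw [← h.bot v hv]
      zify
      simp [h' v A, hxA, hc, hpA, hqA]
    · rw [← h.top v hv]
      zify
      simp [h' v B, hx, hcB, hp, hq]
      ring
  have hcnt : cnt G' x A = cnt G x A := by
    have h1 : x ≠ p := fun e => hx (e ▸ hp)
    have h2 : x ≠ q := fun e => hx (e ▸ hq)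
    zify
    simp [h' x A, hcx.symm, h1, h2, hpA, hqA]
  have hpc : p ≠ c := fun e => hpA (e ▸ hc)
  have hpa : p ≠ a := fun e => hpA (e ▸ ha)
  have haq' : a ≠ q := fun e => hqA (e ▸ ha)
  have hpx' := hpx.ne
  rw [← hcnt]
  refine F.lt_cnt_of_private hbal ha hp ?_ hx hax ?_ fun _ => ?_
  · rw [hadj]
    left
    simp only [ne_eq, Sym2.eq_iff]
    grind
  · rw [hadj]
    simp only [ne_eq, Sym2.eq_iff]
    grind
  · rw [hadj]
    simp only [ne_eq, Sym2.eq_iff]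
    grind

/-- If both alternatives fail, there are a missing edge ax and an edge by of the forbidden kinds.
Rigidity compares neighbourhoods and contradicts `Frame.lt_cnt_of_not_adj` or its dual unless x = y
for all such choices; that remaining case is too tight for the counts. -/
theorem Frame.top_complete_or_bottom_isolated {f : V → ℕ} {A B : Finset V} {k : ℕ}
    (F : Frame f A B k) {G : SimpleGraph V} (h : BalancedGraph f A B k G) :
    (∀ a ∈ A, ∀ x ∉ B, a ≠ x → G.Adj a x) ∨ (∀ b ∈ B, ∀ y ∉ A, ¬ G.Adj b y) := by
  have hk := F.pos
  have hbound : ∀ y ∉ A, ∀ b ∈ B, G.Adj b y → cnt G y B + (if y ∈ B then 1 else 0) < k := by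
    intro y hy b hb hby
    have h1 := F.compl.lt_cnt_of_not_adj (h.compl F) hb hy hby.ne (by simp [hby])
    have h2 := cnt_compl_graph G y B
    rw [F.cardB] at h2
    omega
  have main : ∀ a ∈ A, ∀ x ∉ B, a ≠ x → ¬ G.Adj a x → ∀ b ∈ B, ∀ y ∉ A, G.Adj b y → x = y := by
    intro a ha x hx hax nax b hb y hy hby
    by_contra hxy
    -- If xy is an edge, all B-neighbours of a other than y are neighbours of y, which has too few.
    -- If not, all A-neighbours of x are neighbours of b, which has only k.
    by_cases hadj : G.Adj x y
    · have hsub : ({c ∈ B | G.Adj a c}) ⊆ insert y ({c ∈ B | G.Adj y c}) := by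
        intro c hc
        simp only [mem_filter, mem_insert] at hc ⊢
        by_contra! hcon
        exact F.not_adj h.deg ha hc.1 hc.2 hx hax nax hy hcon.1
          (fun e => hcon.2 hc.1 e.symm) hadj
      have h1 := hbound y hy b hb hby
      have h2 : k = #({c ∈ B | G.Adj a c}) := (h.top a ha).symm
      by_cases hyB : y ∈ B
      · rw [if_pos hyB] at h1
        have := (card_le_card hsub).trans (card_insert_le _ _)
        unfold cnt at h1
        omega
      · rw [if_neg hyB] at h1
        have hsub' : ({c ∈ B | G.Adj a c}) ⊆ ({c ∈ B | G.Adj y c}) := by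
          intro c hc
          rcases mem_insert.1 (hsub hc) with e | e
          · exact absurd (e ▸ (mem_filter.1 hc).1) hyB
          · exact e
        have := card_le_card hsub'
        unfold cnt at h1
        omega
    · have h1 := F.lt_cnt_of_not_adj h ha hx hax nax
      have hsub : ({c ∈ A | G.Adj x c}) ⊆ ({c ∈ A | G.Adj b c}) := by
        intro c hc
        simp only [mem_filter] at hc ⊢
        refine ⟨hc.1, ?_⟩
        by_contra hcb
        exact hadj (F.adj h.deg hc.1 hb (fun e => hcb e.symm) hx hc.2.symm hy hby hxy)
      have := card_le_card hsub
      have h2 := h.bot b hb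
      unfold cnt at h1 h2
      omega
  by_contra! hcon
  obtain ⟨⟨a, ha, x, hx, hax, nax⟩, b, hb, y, hy, hby⟩ := hcon
  -- Now x lies outside A ∪ B, and b is the only B-neighbour of a. So k = 1, but x then needs two
  -- neighbours in A while missing a, one of the two vertices of A.
  obtain rfl := main a ha x hx hax nax b hb y hy hby
  have hbA := Finset.disjoint_right.1 F.disj hb
  have hind : ∀ c ∈ B, ¬ G.Adj b c := by
    intro c hc hbc
    exact hx (main a ha x hx hax nax b hb c (Finset.disjoint_right.1 F.disj hc) hbc ▸ hc)
  have hsub : ({c ∈ B | G.Adj a c}) ⊆ {b} := by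
    intro c hc
    simp only [mem_filter, mem_singleton] at hc ⊢
    by_contra hcb
    exact F.not_adj h.deg ha hc.1 hc.2 hx hax nax hbA hcb (fun e => hind c hc.1 e.symm) hby.symm
  have h1 := card_le_card hsub
  have h2 := h.top a ha
  have h3 := F.lt_cnt_of_not_adj h ha hx hax nax
  have h4 : cnt G x A ≤ #(A.erase a) := by
    refine card_le_card fun c hc => ?_
    simp only [mem_filter, mem_erase] at hc ⊢
    exact ⟨fun e => nax (e ▸ hc.2.symm), hc.1⟩
  rw [card_erase_of_mem ha, F.cardA] at h4
  rw [card_singleton] at h1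
  unfold cnt at h2
  omega

/-- If all graphs with degrees `f` have `2k²` edges between the extreme degree classes, then these
classes have an extreme position. -/
theorem Frame.degree_eq {f : V → ℕ} {A B : Finset V} {k : ℕ} (F : Frame f A B k)
    (G : SimpleGraph V) (hG : ∀ v, cnt G v univ = f v) :
    (∀ a ∈ A, f a + k + 1 = Fintype.card V) ∨ ∀ b ∈ B, f b = k := by
  obtain ⟨G', h⟩ := F.exists_balanced G hG
  rcases F.top_complete_or_bottom_isolated h with hc | hc
  · left
    intro a ha
    have haB := Finset.disjoint_left.1 F.disj ha
    have h1 : cnt G'ᶜ a Bᶜ = 0 := by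
      rw [cnt_eq_zero_iff]
      intro x hx hax
      rw [mem_compl] at hx
      exact hax.2 (hc a ha x hx hax.1)
    have h2 := cnt_compl_graph G' a Bᶜ
    rw [h1, if_pos (by simpa using haB), card_compl, F.cardB] at h2
    have h3 := cnt_add_cnt_compl G' a B
    rw [h.deg, h.top a ha] at h3
    have := card_le_univ B
    rw [F.cardB] at this
    omega
  · right
    intro b hb
    have h3 := cnt_add_cnt_compl G' b A
    have h1 : cnt G' b Aᶜ = 0 := by
      rw [cnt_eq_zero_iff]
      intro x hx
      exact hc b hb x (by simpa using hx)
    rw [h.deg, h.bot b hb, h1] at h3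
    omega

end

/-! ### Antimorphisms, degree multiplicities and the split composition. -/

section
open Finset Classical

variable {V : Type} [Fintype V]

/-- `g` exchanges adjacency and non-adjacency of distinct vertices. -/
def IsAntimorphism {V : Type} (G : SimpleGraph V) (g : V → V) : Prop :=
  Function.Injective g ∧ ∀ u v, u ≠ v → (G.Adj (g u) (g v) ↔ ¬ G.Adj u v)

theorem isSelfComplementary_iff (G : SimpleGraph V) :
    IsSelfComplementary G ↔ ∃ g : V → V, IsAntimorphism G g := by
  constructor
  · rintro ⟨σ⟩
    refine ⟨σ.symm, σ.symm.injective, fun u v huv => ?_⟩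
    have := σ.symm.map_rel_iff (a := u) (b := v)
    rw [SimpleGraph.compl_adj] at this
    exact this.trans (by simp [huv])
  · rintro ⟨g, hg, h⟩
    let e := Equiv.ofBijective g (Finite.injective_iff_bijective.1 hg)
    refine ⟨(⟨e, ?_⟩ : Gᶜ ≃g G).symm⟩
    intro u v
    change G.Adj (g u) (g v) ↔ _
    rw [SimpleGraph.compl_adj]
    by_cases huv : u = v
    · subst huv; simp
    · rw [h u v huv]; simp [huv]

theorem IsAntimorphism.cnt_image {V : Type} {G : SimpleGraph V} {g : V → V}
    (hg : IsAntimorphism G g) (v : V) (S : Finset V) :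
    cnt G (g v) (S.image g) = cnt Gᶜ v S := by
  unfold cnt
  rw [filter_image, card_image_of_injective _ hg.1]
  congr 1
  ext u
  simp only [mem_filter, SimpleGraph.compl_adj]
  refine and_congr_right fun _ => ?_
  by_cases huv : v = u
  · subst huv; simp
  · rw [hg.2 v u huv]; simp [huv]

theorem IsAntimorphism.surjective {G : SimpleGraph V} {g : V → V}
    (hg : IsAntimorphism G g) : Function.Surjective g := Finite.injective_iff_surjective.1 hg.1

theorem IsAntimorphism.cnt_univ {G : SimpleGraph V} {g : V → V}
    (hg : IsAntimorphism G g) (v : V) :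
    cnt G (g v) univ + cnt G v univ + 1 = Fintype.card V := by
  have h1 := hg.cnt_image v univ
  rw [image_univ_of_surjective hg.surjective] at h1
  have h2 := cnt_compl_graph G v univ
  simp only [mem_univ, if_true, card_univ] at h2
  omega

/-- The degrees of `G` are `d 1, …, d ℓ`, with `n i` vertices of degree `d i`. -/
def Realizes (G : SimpleGraph V) (ℓ : ℕ) (d n : ℕ → ℕ) : Prop :=
  (∀ v, ∃ i ∈ Set.Icc 1 ℓ, cnt G v univ = d i) ∧
    ∀ i ∈ Set.Icc 1 ℓ, #{v | cnt G v univ = d i} = n i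

theorem compactSequence_succ (ℓ : ℕ) (d n : ℕ → ℕ) :
    compactSequence (ℓ + 1) d n =
      compactSequence ℓ d n ++ List.replicate (n (ℓ + 1)) (d (ℓ + 1)) := by
  simp [compactSequence, List.range'_concat, add_comm]

theorem mem_compactSequence {ℓ : ℕ} {d n : ℕ → ℕ} {x : ℕ} (h : x ∈ compactSequence ℓ d n) :
    ∃ i ∈ Set.Icc 1 ℓ, x = d i := by
  simp only [compactSequence, List.mem_flatMap, List.mem_range'_1, List.mem_replicate] at h
  obtain ⟨i, hi, -, rfl⟩ := h
  exact ⟨i, ⟨hi.1, by omega⟩, rfl⟩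

theorem sortedGE_compactSequence (ℓ : ℕ) (d n : ℕ → ℕ) (hd : StrictAntiOn d (Set.Icc 1 ℓ)) :
    (compactSequence ℓ d n).Pairwise (· ≥ ·) := by
  induction ℓ with
  | zero => simp [compactSequence]
  | succ ℓ ih =>
    rw [compactSequence_succ, List.pairwise_append]
    refine ⟨ih (hd.mono (Set.Icc_subset_Icc_right (by omega))), ?_, ?_⟩
    · rw [List.pairwise_replicate]; simp
    · intro x hx y hy
      obtain ⟨i, hi, rfl⟩ := mem_compactSequence hx
      rw [List.eq_of_mem_replicate hy]
      exact (hd ⟨hi.1, by have := hi.2; omega⟩ ⟨by omega, le_rfl⟩ (by have := hi.2; omega)).le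

theorem count_compactSequence (ℓ : ℕ) (d n : ℕ → ℕ) (hd : StrictAntiOn d (Set.Icc 1 ℓ))
    {i : ℕ} (hi : i ∈ Set.Icc 1 ℓ) : (compactSequence ℓ d n).count (d i) = n i := by
  induction ℓ with
  | zero => have := hi.1; have := hi.2; omega
  | succ ℓ ih =>
    rw [compactSequence_succ, List.count_append, List.count_replicate]
    have hd' := hd.mono (Set.Icc_subset_Icc_right (Nat.le_succ ℓ))
    by_cases h : i = ℓ + 1
    · subst h
      rw [List.count_eq_zero_of_not_mem]
      · simp
      · intro hx
        obtain ⟨j, hj, hj'⟩ := mem_compactSequence hx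
        have := hd.injOn hi ⟨hj.1, by have := hj.2; omega⟩ hj'
        have := hj.2
        omega
    · have hi' : i ∈ Set.Icc 1 ℓ := ⟨hi.1, by have := hi.2; omega⟩
      rw [ih hd' hi', if_neg]
      · rfl
      · intro e
        exact h (hd.injOn hi ⟨by omega, le_rfl⟩ (beq_iff_eq.1 e).symm)

theorem count_degrees (G : SimpleGraph V) (x : ℕ) :
    (Finset.univ.val.map fun v : V => G.degree v).count x = #{v | cnt G v univ = x} := by
  rw [Multiset.count_map, card_def, filter_val]
  simp only [cnt_univ, eq_comm]

theorem degreeSequence_eq_iff (G : SimpleGraph V) (ℓ : ℕ) (d n : ℕ → ℕ)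
    (hd : StrictAntiOn d (Set.Icc 1 ℓ)) :
    degreeSequence G = compactSequence ℓ d n ↔ Realizes G ℓ d n := by
  have h1 : degreeSequence G = compactSequence ℓ d n ↔
      (Finset.univ.val.map fun v : V => G.degree v) = (compactSequence ℓ d n : Multiset ℕ) := by
    unfold degreeSequence
    constructor
    · intro h
      rw [← h, Multiset.sort_eq]
    · intro h
      refine List.Perm.eq_of_pairwise' (Multiset.pairwise_sort _ _)
        (sortedGE_compactSequence ℓ d n hd) ?_
      rw [← Multiset.coe_eq_coe, Multiset.sort_eq, h]
  rw [h1]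
  constructor
  · intro h
    refine ⟨fun v => ?_, fun i hi => ?_⟩
    · apply mem_compactSequence (n := n)
      rw [← Multiset.mem_coe, ← h, cnt_univ]
      exact Multiset.mem_map_of_mem _ (mem_univ_val v)
    · rw [← count_degrees, h, Multiset.coe_count, count_compactSequence ℓ d n hd hi]
  · rintro ⟨h, h'⟩
    ext x
    rw [count_degrees, Multiset.coe_count]
    by_cases hx : ∃ i ∈ Set.Icc 1 ℓ, x = d i
    · obtain ⟨i, hi, rfl⟩ := hx
      rw [h' i hi, count_compactSequence ℓ d n hd hi]
    · rw [List.count_eq_zero_of_not_mem fun hm => hx (mem_compactSequence hm), card_eq_zero,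
        filter_eq_empty_iff]
      intro v _ hv
      obtain ⟨i, hi, e⟩ := h v
      exact hx ⟨i, hi, hv.symm.trans e⟩

theorem Realizes.card_eq {G : SimpleGraph V} {ℓ : ℕ} {d n : ℕ → ℕ}
    (hd : StrictAntiOn d (Set.Icc 1 ℓ)) (h : Realizes G ℓ d n) :
    Fintype.card V = ∑ i ∈ Icc 1 ℓ, n i := by
  rw [← sum_congr rfl fun i hi => h.2 i (by simpa using hi), ← card_biUnion, ← card_univ]
  · congr 1
    ext v
    obtain ⟨i, hi, e⟩ := h.1 v
    simp only [mem_univ, mem_biUnion, mem_filter, true_and, true_iff]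
    exact ⟨i, by simpa using hi, e⟩
  · intro i hi j hj hij
    rw [Function.onFun, disjoint_filter]
    intro v _ h1 h2
    exact hij (hd.injOn (by simpa using hi) (by simpa using hj) (h1.symm.trans h2))

/-- The composition of the split graph with clique `α`, independent set `β` and cross adjacency `R`
with the graph `H`: every vertex of `H` is joined to the clique only. -/
def splitCompose {α β W : Type} (R : α → β → Prop) (H : SimpleGraph W) :
    SimpleGraph (α ⊕ β ⊕ W) where
  Adj
    | .inl a, .inl a' => a ≠ a'
    | .inl a, .inr (.inl b) => R a b
    | .inr (.inl b), .inl a => R a b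
    | .inl _, .inr (.inr _) => True
    | .inr (.inr _), .inl _ => True
    | .inr (.inl _), .inr _ => False
    | .inr (.inr _), .inr (.inl _) => False
    | .inr (.inr w), .inr (.inr w') => H.Adj w w'
  symm := ⟨by
    rintro (a | b | w) (a' | b' | w') h <;> first | exact h | exact h.symm⟩
  loopless := ⟨by
    rintro (a | b | w) h
    · exact h rfl
    · exact h
    · exact H.loopless.irrefl w h⟩

section splitCompose

variable {α β W : Type} [Fintype α] [Fintype β] [Fintype W] (R : α → β → Prop) (H : SimpleGraph W)

theorem cnt_sum_type (G : SimpleGraph (α ⊕ β ⊕ W)) (v : α ⊕ β ⊕ W) :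
    cnt G v univ = #{a | G.Adj v (.inl a)} + #{b | G.Adj v (.inr (.inl b))} +
      #{w | G.Adj v (.inr (.inr w))} := by
  zify
  rw [cnt_eq_sum, Fintype.sum_sum_type, Fintype.sum_sum_type]
  simp [add_assoc]

theorem splitCompose_cnt_inl (a : α) : cnt (splitCompose R H) (.inl a) univ + 1 =
    Fintype.card α + #{b | R a b} + Fintype.card W := by
  have h1 : #{x | (splitCompose R H).Adj (.inl a) (.inl x)} = #(univ.erase a) := by
    congr 1
    ext x
    rw [mem_filter]
    simp [splitCompose, eq_comm]
  have h2 : #{b | (splitCompose R H).Adj (.inl a) (.inr (.inl b))} = #{b | R a b} := rfl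
  have h3 : #{w | (splitCompose R H).Adj (.inl a) (.inr (.inr w))} = Fintype.card W := by
    rw [← card_univ]
    congr 1
    ext x
    rw [mem_filter]
    simp [splitCompose]
  have : 0 < Fintype.card α := Fintype.card_pos_iff.2 ⟨a⟩
  rw [cnt_sum_type, h1, h2, h3, card_erase_of_mem (mem_univ a), card_univ]
  omega

theorem splitCompose_cnt_inr_inl (b : β) : cnt (splitCompose R H) (.inr (.inl b)) univ =
    #{a | R a b} := by
  have h1 : #{x | (splitCompose R H).Adj (.inr (.inl b)) (.inl x)} = #{a | R a b} := rfl
  have h2 : #{x | (splitCompose R H).Adj (.inr (.inl b)) (.inr (.inl x))} = 0 := by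
    rw [card_eq_zero, filter_eq_empty_iff]
    exact fun _ _ h => h
  have h3 : #{w | (splitCompose R H).Adj (.inr (.inl b)) (.inr (.inr w))} = 0 := by
    rw [card_eq_zero, filter_eq_empty_iff]
    exact fun _ _ h => h
  rw [cnt_sum_type, h1, h2, h3, add_zero, add_zero]

theorem splitCompose_cnt_inr_inr (w : W) : cnt (splitCompose R H) (.inr (.inr w)) univ =
    Fintype.card α + cnt H w univ := by
  have h1 : #{x | (splitCompose R H).Adj (.inr (.inr w)) (.inl x)} = Fintype.card α := by
    rw [← card_univ]
    congr 1
    ext x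
    rw [mem_filter]
    simp [splitCompose]
  have h2 : #{x | (splitCompose R H).Adj (.inr (.inr w)) (.inr (.inl x))} = 0 := by
    rw [card_eq_zero, filter_eq_empty_iff]
    exact fun _ _ h => h
  have h3 : #{x | (splitCompose R H).Adj (.inr (.inr w)) (.inr (.inr x))} = cnt H w univ := rfl
  rw [cnt_sum_type, h1, h2, h3, add_zero]

theorem splitCompose_isAntimorphism {α β W : Type} (R : α → β → Prop) (H : SimpleGraph W)
    {g : W → W} (hg : IsAntimorphism H g) {s : α → β} {t : β → α}
    (hs : s.Injective) (ht : t.Injective) (h : ∀ a b, R (t b) (s a) ↔ ¬ R a b) :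
    ∃ g', IsAntimorphism (splitCompose R H) g' := by
  refine ⟨Sum.elim (fun a => .inr (.inl (s a)))
    (Sum.elim (fun b => .inl (t b)) fun w => .inr (.inr (g w))), ?_, ?_⟩
  · rintro (a | b | w) (a' | b' | w') e <;> simp at e ⊢
    · exact hs e
    · exact ht e
    · exact hg.1 e
  · rintro (a | b | w) (a' | b' | w') hne <;>
      simp only [splitCompose, Sum.elim_inl, Sum.elim_inr, ne_eq, Sum.inl.injEq, Sum.inr.injEq,
        not_true_eq_false, not_false_eq_true, iff_true, false_iff, not_not] at hne ⊢
    · exact hne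
    · exact h a b'
    · exact h a' b
    · exact fun e => hne (ht e)
    · exact hg.2 w w' hne

end splitCompose

end

/-! ### Peeling off the extreme classes. -/

section
open Finset Classical

variable {V : Type} [Fintype V]

theorem cnt_mono {V : Type} {G : SimpleGraph V} {v : V} {S T : Finset V} (h : S ⊆ T) :
    cnt G v S ≤ cnt G v T := card_le_card (filter_subset_filter _ h)

/-- Classes `A` and `B` of size `2k` whose degrees are `|V| - 1 - k` and `k` are in extreme
position. -/
theorem extreme_classes {G : SimpleGraph V} {A B : Finset V} {k : ℕ} (hAB : Disjoint A B)
    (cA : #A = 2 * k) (cB : #B = 2 * k) (dA : ∀ a ∈ A, cnt G a univ + k + 1 = Fintype.card V)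
    (dB : ∀ b ∈ B, cnt G b univ = k) :
    (∀ a ∈ A, ∀ x ∉ B, a ≠ x → G.Adj a x) ∧ (∀ b ∈ B, ∀ y ∉ A, ¬ G.Adj b y) ∧
      (∀ a ∈ A, cnt G a B = k) ∧ ∀ b ∈ B, cnt G b A = k := by
  have cdeg : ∀ a ∈ A, cnt Gᶜ a univ = k := by
    intro a ha
    have := cnt_compl_graph G a univ
    have := dA a ha
    simp only [mem_univ, if_true, card_univ] at *
    omega
  have cnt_add : ∀ a ∈ A, cnt Gᶜ a B + cnt G a B = 2 * k := by
    intro a ha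
    have := cnt_compl_graph G a B
    rw [if_neg (Finset.disjoint_left.1 hAB ha), cB] at this
    omega
  -- Only k vertices are non-neighbours of a, while B has 2k vertices.
  have hA : ∀ a ∈ A, k ≤ cnt G a B := by
    intro a ha
    have h1 : cnt Gᶜ a B ≤ _ := cnt_mono (subset_univ B)
    rw [cdeg a ha] at h1
    have := cnt_add a ha
    omega
  have hB : ∀ b ∈ B, cnt G b A ≤ k := by
    intro b hb
    have h1 : cnt G b A ≤ _ := cnt_mono (subset_univ A)
    rwa [dB b hb] at h1
  have hs := sum_cnt_comm G A B
  have s1 : ∑ b ∈ B, cnt G b A ≤ ∑ b ∈ B, k := sum_le_sum hB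
  have s2 : ∑ a ∈ A, k ≤ ∑ a ∈ A, cnt G a B := sum_le_sum hA
  have s3 : ∑ a ∈ A, k = ∑ b ∈ B, k := by simp [cA, cB]
  have eA : ∀ a ∈ A, cnt G a B = k := fun a ha =>
    ((sum_eq_sum_iff_of_le hA).1 (by omega) a ha).symm
  have eB : ∀ b ∈ B, cnt G b A = k := (sum_eq_sum_iff_of_le hB).1 (by omega)
  refine ⟨fun a ha x hx hax => ?_, fun b hb y hy => ?_, eA, eB⟩
  · have h1 := cnt_add_cnt_compl Gᶜ a B
    have h2 := cnt_add a ha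
    rw [cdeg a ha] at h1
    rw [eA a ha] at h2
    have h0 : cnt Gᶜ a Bᶜ = 0 := by omega
    have := cnt_eq_zero_iff.1 h0 x (by simpa using hx)
    by_contra hcon
    exact this ⟨hax, hcon⟩
  · have h1 := cnt_add_cnt_compl G b A
    rw [dB b hb, eB b hb] at h1
    have h0 : cnt G b Aᶜ = 0 := by omega
    exact cnt_eq_zero_iff.1 h0 y (by simpa using hy)

theorem cnt_univ_iso {W : Type} [Fintype W] {G : SimpleGraph V} {H : SimpleGraph W} (e : H ≃g G)
    (w : W) : cnt G (e w) univ = cnt H w univ := by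
  zify
  rw [cnt_eq_sum, cnt_eq_sum]
  refine (Fintype.sum_equiv e.toEquiv _ _ fun u => ?_).symm
  exact if_congr e.map_rel_iff.symm rfl rfl

theorem IsSelfComplementary.of_iso {V W : Type} {G : SimpleGraph V} {H : SimpleGraph W} (e : H ≃g G)
    (h : IsSelfComplementary H) : IsSelfComplementary G := by
  obtain ⟨σ⟩ := h
  have ec : Hᶜ ≃g Gᶜ := ⟨e.toEquiv, by
    intro a b
    have := e.map_rel_iff (a := a) (b := b)
    simp only [SimpleGraph.compl_adj, ne_eq, EmbeddingLike.apply_eq_iff_eq]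
    exact and_congr_right fun _ => not_congr this⟩
  exact ⟨(e.symm.trans σ).trans ec⟩

/-- `R` is a bipartite graph, regular of degree `k`, on classes of size `2k`. -/
structure HalfRegular {α β : Type} [Fintype α] [Fintype β] (R : α → β → Prop) (k : ℕ) : Prop where
  cardL : Fintype.card α = 2 * k
  cardR : Fintype.card β = 2 * k
  row : ∀ a, #{b | R a b} = k
  col : ∀ b, #{a | R a b} = k

theorem Realizes.exists_splitCompose {G : SimpleGraph V} {ℓ k : ℕ} {d n : ℕ → ℕ}
    (hd : StrictAntiOn d (Set.Icc 1 (ℓ + 2))) (hn : ∀ i ∈ Set.Icc 1 (ℓ + 2), 1 ≤ n i)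
    (h : Realizes G (ℓ + 2) d n) (n1 : n 1 = 2 * k) (nl : n (ℓ + 2) = 2 * k)
    (d1 : d 1 + k + 1 = Fintype.card V) (dl : d (ℓ + 2) = k) :
    ∃ (α β W : Type) (_ : Fintype α) (_ : Fintype β) (_ : Fintype W) (R : α → β → Prop)
      (H : SimpleGraph W), HalfRegular R k ∧ Nonempty (splitCompose R H ≃g G) ∧
      Realizes H ℓ (fun i => d (i + 1) - 2 * k) (fun i => n (i + 1)) ∧
      ∀ i ∈ Set.Icc 1 ℓ, 2 * k ≤ d (i + 1) := by
  set A : Finset V := {v | cnt G v univ = d 1} with hA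
  set B : Finset V := {v | cnt G v univ = d (ℓ + 2)} with hB
  have i1 : 1 ∈ Set.Icc 1 (ℓ + 2) := ⟨le_rfl, by omega⟩
  have il : ℓ + 2 ∈ Set.Icc 1 (ℓ + 2) := ⟨by omega, le_rfl⟩
  have hlt : d (ℓ + 2) < d 1 := hd i1 il (by omega)
  have mA : ∀ v, v ∈ A ↔ cnt G v univ = d 1 := fun v => by simp [hA]
  have mB : ∀ v, v ∈ B ↔ cnt G v univ = d (ℓ + 2) := fun v => by simp [hB]
  have hAB : Disjoint A B := by
    rw [Finset.disjoint_left]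
    intro v h1 h2
    rw [mA] at h1
    rw [mB] at h2
    omega
  have cA : #A = 2 * k := (h.2 1 i1).trans n1
  have cB : #B = 2 * k := (h.2 _ il).trans nl
  obtain ⟨sA, sB, eA, eB⟩ := extreme_classes (G := G) (k := k) hAB cA cB
    (fun a ha => by rw [(mA a).1 ha]; exact d1) (fun b hb => by rw [(mB b).1 hb]; exact dl)
  let W := {v // v ∉ A ∧ v ∉ B}
  let H : SimpleGraph W := G.comap Subtype.val
  let R : {v // v ∈ A} → {v // v ∈ B} → Prop := fun a b => G.Adj a b
  have hR : HalfRegular R k := by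
    refine ⟨by simpa using cA, by simpa using cB, fun a => ?_, fun b => ?_⟩
    · rw [← eA a a.2, cnt]
      refine card_bij (fun b _ => b.1) (fun b hb => ?_) (fun b _ b' _ e => Subtype.ext e)
        (fun b hb => ?_)
      · simpa [R] using hb
      · rw [mem_filter] at hb
        exact ⟨⟨b, hb.1⟩, by simpa [R] using hb.2, rfl⟩
    · rw [← eB b b.2, cnt]
      refine card_bij (fun b _ => b.1) (fun b hb => ?_) (fun b _ b' _ e => Subtype.ext e)
        (fun b hb => ?_)
      · simpa [R, G.adj_comm] using hb
      · rw [mem_filter] at hb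
        exact ⟨⟨b, hb.1⟩, by simpa [R] using hb.2.symm, rfl⟩
  let φ : {v // v ∈ A} ⊕ {v // v ∈ B} ⊕ W → V :=
    Sum.elim Subtype.val (Sum.elim Subtype.val Subtype.val)
  have hφ : φ.Bijective := by
    constructor
    · rintro (⟨a, ha⟩ | ⟨a, ha⟩ | ⟨a, ha⟩) (⟨b, hb⟩ | ⟨b, hb⟩ | ⟨b, hb⟩) e <;>
        simp only [φ, Sum.elim_inl, Sum.elim_inr] at e <;> subst e
      · rfl
      · exact absurd hb (Finset.disjoint_left.1 hAB ha)
      · exact absurd ha hb.1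
      · exact absurd hb (Finset.disjoint_right.1 hAB ha)
      · rfl
      · exact absurd ha hb.2
      · exact absurd hb ha.1
      · exact absurd hb ha.2
      · rfl
    · intro v
      by_cases h1 : v ∈ A
      · exact ⟨.inl ⟨v, h1⟩, rfl⟩
      by_cases h2 : v ∈ B
      · exact ⟨.inr (.inl ⟨v, h2⟩), rfl⟩
      · exact ⟨.inr (.inr ⟨v, h1, h2⟩), rfl⟩
  have hiso : ∀ u v, G.Adj (φ u) (φ v) ↔ (splitCompose R H).Adj u v := by
    rintro (⟨a, ha⟩ | ⟨a, ha⟩ | ⟨a, ha⟩) (⟨b, hb⟩ | ⟨b, hb⟩ | ⟨b, hb⟩) <;>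
      simp only [φ, Sum.elim_inl, Sum.elim_inr, splitCompose, R, H, SimpleGraph.comap_adj, ne_eq,
        Subtype.mk.injEq, iff_true, iff_false]
    · exact ⟨fun h => h.ne, sA a ha b (Finset.disjoint_left.1 hAB hb)⟩
    · exact sA a ha b hb.2 fun e => hb.1 (e ▸ ha)
    · exact G.adj_comm _ _
    · exact sB a ha b (Finset.disjoint_right.1 hAB hb)
    · exact sB a ha b hb.1
    · exact (sA b hb a ha.2 fun e => ha.1 (e ▸ hb)).symm
    · exact fun h => sB b hb a ha.1 h.symm
  let e : splitCompose R H ≃g G := ⟨Equiv.ofBijective φ hφ, fun {u v} => hiso u v⟩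
  have degW : ∀ w : W, cnt G w.1 univ = 2 * k + cnt H w univ := by
    intro w
    have := cnt_univ_iso e (.inr (.inr w))
    rw [splitCompose_cnt_inr_inr, hR.cardL] at this
    exact this
  have mid : ∀ i ∈ Set.Icc 1 ℓ, ∀ v, cnt G v univ = d (i + 1) → v ∉ A ∧ v ∉ B := by
    intro i hi v hv
    have hi' : i + 1 ∈ Set.Icc 1 (ℓ + 2) := ⟨by omega, by have := hi.2; omega⟩
    rw [mA, mB, hv]
    have h1 := hi.1
    have h2 := hi.2
    exact ⟨fun e => by have := hd.injOn hi' i1 e; omega,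
      fun e => by have := hd.injOn hi' il e; omega⟩
  -- Every middle degree is attained by a vertex joined to all 2k vertices of A, so the subtraction
  -- in the shortened sequence is not truncated.
  have hge : ∀ i ∈ Set.Icc 1 ℓ, 2 * k ≤ d (i + 1) := by
    intro i hi
    have hi' : i + 1 ∈ Set.Icc 1 (ℓ + 2) := ⟨by omega, by have := hi.2; omega⟩
    have hni := hn _ hi'
    rw [← h.2 _ hi'] at hni
    obtain ⟨v, hv⟩ := card_pos.1 hni
    simp only [mem_filter, mem_univ, true_and] at hv
    have := degW ⟨v, mid i hi v hv⟩
    simp only [hv] at this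
    omega
  refine ⟨_, _, W, inferInstance, inferInstance, inferInstance, R, H, hR, ⟨e⟩, ⟨?_, ?_⟩, hge⟩
  · intro w
    obtain ⟨i, hi, hiw⟩ := h.1 w.1
    have h1 : i ≠ 1 := fun e => w.2.1 ((mA _).2 (e ▸ hiw))
    have h2 : i ≠ ℓ + 2 := fun e => w.2.2 ((mB _).2 (e ▸ hiw))
    have h3 := hi.1
    have h4 := hi.2
    refine ⟨i - 1, ⟨by omega, by omega⟩, ?_⟩
    have := degW w
    have e1 : i - 1 + 1 = i := by omega
    simp only [e1]
    omega
  · intro i hi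
    have hi' : i + 1 ∈ Set.Icc 1 (ℓ + 2) := ⟨by omega, by have := hi.2; omega⟩
    have hk := hge i hi
    refine Eq.trans ?_ (h.2 _ hi')
    refine card_bij (fun w _ => w.1) (fun w hw => ?_) (fun b _ b' _ e => Subtype.ext e)
        (fun v hv => ?_)
    · simp only [mem_filter, mem_univ, true_and] at hw ⊢
      rw [degW w, hw]
      omega
    · simp only [mem_filter, mem_univ, true_and] at hv ⊢
      have := degW ⟨v, mid i hi v hv⟩
      simp only [hv] at this
      exact ⟨⟨v, mid i hi v hv⟩, by omega, rfl⟩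

theorem Realizes.splitCompose {α β W : Type} [Fintype α] [Fintype β] [Fintype W]
    {R : α → β → Prop} {H : SimpleGraph W} {ℓ k : ℕ} {d n : ℕ → ℕ} (hR : HalfRegular R k)
    (hk : 1 ≤ k) (hd : StrictAntiOn d (Set.Icc 1 (ℓ + 2)))
    (n1 : n 1 = 2 * k) (nl : n (ℓ + 2) = 2 * k) (d1 : d 1 + 1 = 3 * k + Fintype.card W)
    (dl : d (ℓ + 2) = k) (hge : ∀ i ∈ Set.Icc 1 ℓ, 2 * k ≤ d (i + 1))
    (h : Realizes H ℓ (fun i => d (i + 1) - 2 * k) (fun i => n (i + 1))) :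
    Realizes (splitCompose R H) (ℓ + 2) d n := by
  have i1 : 1 ∈ Set.Icc 1 (ℓ + 2) := ⟨le_rfl, by omega⟩
  have il : ℓ + 2 ∈ Set.Icc 1 (ℓ + 2) := ⟨by omega, le_rfl⟩
  have da : ∀ a : α, cnt (_root_.splitCompose R H) (.inl a) univ = d 1 := by
    intro a
    have := splitCompose_cnt_inl R H a
    rw [hR.cardL, hR.row] at this
    omega
  have db : ∀ b : β, cnt (_root_.splitCompose R H) (.inr (.inl b)) univ = d (ℓ + 2) := by
    intro b
    rw [splitCompose_cnt_inr_inl, hR.col, dl]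
  have dw : ∀ w : W, cnt (_root_.splitCompose R H) (.inr (.inr w)) univ =
      2 * k + cnt H w univ := by
    intro w
    rw [splitCompose_cnt_inr_inr, hR.cardL]
  refine ⟨?_, ?_⟩
  · rintro (a | b | w)
    · exact ⟨1, i1, da a⟩
    · exact ⟨ℓ + 2, il, db b⟩
    · obtain ⟨i, hi, e⟩ := h.1 w
      have := hge i hi
      exact ⟨i + 1, ⟨by omega, by have := hi.2; omega⟩, by rw [dw, e]; simp only; omega⟩
  · intro i hi
    have hsum : ∀ x, #{v | cnt (_root_.splitCompose R H) v univ = x} =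
        #{_a : α | d 1 = x} + #{_b : β | d (ℓ + 2) = x} +
          #{w : W | 2 * k + cnt H w univ = x} := by
      intro x
      simp only [card_filter, Fintype.sum_sum_type, da, db, dw, add_assoc]
    rw [hsum]
    have hcard : ∀ j ∈ Set.Icc 1 (ℓ + 2), d j = d i ↔ j = i :=
      fun j hj => ⟨fun e => hd.injOn hj hi e, fun e => by rw [e]⟩
    simp only [hcard 1 i1, hcard _ il]
    have hi1 := hi.1
    have hi2 := hi.2
    rcases (by omega : i = 1 ∨ i = ℓ + 2 ∨ (i ≠ 1 ∧ i ≠ ℓ + 2)) with rfl | rfl | ⟨h1, h2⟩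
    · have : #{w : W | 2 * k + cnt H w univ = d 1} = 0 := by
        rw [card_eq_zero, filter_eq_empty_iff]
        intro w _ e
        obtain ⟨j, hj, e'⟩ := h.1 w
        simp only at e'
        have := hge j hj
        have := hd.injOn i1 (⟨by omega, by have := hj.2; omega⟩ : j + 1 ∈ Set.Icc 1 (ℓ + 2))
          (by omega)
        have := hj.1
        omega
      rw [this]
      simp [hR.cardL, n1]
    · have : #{w : W | 2 * k + cnt H w univ = d (ℓ + 2)} = 0 := by
        rw [card_eq_zero, filter_eq_empty_iff]
        intro w _ e
        omega
      rw [this]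
      simp [hR.cardR, nl]
    · have hj : i - 1 ∈ Set.Icc 1 ℓ := ⟨by omega, by omega⟩
      have e1 : i - 1 + 1 = i := by omega
      have := h.2 _ hj
      have hg := hge _ hj
      simp only [e1] at this hg
      rw [← this]
      simp only [Ne.symm h1, Ne.symm h2, filter_false, card_empty, zero_add]
      congr 1
      ext w
      simp only [mem_filter, mem_univ, true_and]
      omega

section antimorphism

variable {α β W : Type} [Fintype α] [Fintype β] [Fintype W] {R : α → β → Prop}
  {H : SimpleGraph W} {k : ℕ} {g : α ⊕ β ⊕ W → α ⊕ β ⊕ W}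

/-- Degrees tell the three parts apart: k on β, at least 2k and less than 2k + |W| on W, and 3k +
|W| - 1 on α. The map δ ↦ N - 1 - δ swaps the outer two ranges and preserves the middle one. -/
theorem IsAntimorphism.splitCompose_maps (hR : HalfRegular R k) (hk : 1 ≤ k)
    (hg : IsAntimorphism (splitCompose R H) g) :
    (∀ a, ∃ b, g (.inl a) = .inr (.inl b)) ∧ (∀ b, ∃ a, g (.inr (.inl b)) = .inl a) ∧
      ∀ w, ∃ w', g (.inr (.inr w)) = .inr (.inr w') := by
  have da : ∀ a : α, cnt (splitCompose R H) (.inl a) univ + 1 = 3 * k + Fintype.card W := by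
    intro a
    have := splitCompose_cnt_inl R H a
    rw [hR.cardL, hR.row] at this
    omega
  have db : ∀ b : β, cnt (splitCompose R H) (.inr (.inl b)) univ = k := by
    intro b
    rw [splitCompose_cnt_inr_inl, hR.col]
  have dw : ∀ w : W, 2 * k ≤ cnt (splitCompose R H) (.inr (.inr w)) univ ∧
      cnt (splitCompose R H) (.inr (.inr w)) univ + 1 ≤ 2 * k + Fintype.card W := by
    intro w
    rw [splitCompose_cnt_inr_inr, hR.cardL]
    have := cnt_compl_graph H w univ
    simp only [mem_univ, if_true, card_univ] at this
    omega
  have hs := hg.cnt_univ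
  have hc : Fintype.card (α ⊕ β ⊕ W) = 4 * k + Fintype.card W := by
    rw [Fintype.card_sum, Fintype.card_sum, hR.cardL, hR.cardR]; omega
  rw [hc] at hs
  refine ⟨fun a => ?_, fun b => ?_, fun w => ?_⟩
  · have h1 := hs (.inl a)
    have h2 := da a
    rcases hga : g (.inl a) with a' | b' | w' <;> rw [hga] at h1
    · have := da a'; omega
    · exact ⟨b', rfl⟩
    · have := dw w'; omega
  · have h1 := hs (.inr (.inl b))
    have h2 := db b
    rcases hga : g (.inr (.inl b)) with a' | b' | w' <;> rw [hga] at h1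
    · exact ⟨a', rfl⟩
    · have := db b'; omega
    · have := dw w'; omega
  · have h1 := hs (.inr (.inr w))
    have h2 := dw w
    rcases hga : g (.inr (.inr w)) with a' | b' | w' <;> rw [hga] at h1
    · have := da a'; omega
    · have := db b'; omega
    · exact ⟨w', rfl⟩

theorem IsAntimorphism.of_splitCompose (hR : HalfRegular R k) (hk : 1 ≤ k)
    (hg : IsAntimorphism (splitCompose R H) g) : ∃ g', IsAntimorphism H g' := by
  choose g' hg' using (hg.splitCompose_maps hR hk).2.2
  refine ⟨g', fun u v e => ?_, fun u v huv => ?_⟩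
  · have := @hg.1 (.inr (.inr u)) (.inr (.inr v)) (by rw [hg', hg', e])
    simpa using this
  · have := hg.2 (.inr (.inr u)) (.inr (.inr v)) (by simpa using huv)
    rw [hg', hg'] at this
    exact this

/-- An antimorphism turns columns into complemented rows, so the images of two equal columns are two
equal rows. -/
theorem IsAntimorphism.exists_twin_rows (hR : HalfRegular R k) (hk : 1 ≤ k)
    (hg : IsAntimorphism (splitCompose R H) g) {b b' : β} (hb : b ≠ b')
    (hbb : ∀ a, R a b ↔ R a b') : ∃ a a', a ≠ a' ∧ ∀ c, R a c ↔ R a' c := by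
  obtain ⟨h1, h2, h3⟩ := hg.splitCompose_maps hR hk
  obtain ⟨a, ha⟩ := h2 b
  obtain ⟨a', ha'⟩ := h2 b'
  refine ⟨a, a', fun e => ?_, fun c => ?_⟩
  · have := @hg.1 (.inr (.inl b)) (.inr (.inl b')) (by rw [ha, ha', e])
    exact hb (by simpa using this)
  · obtain ⟨v, hv⟩ := hg.surjective (.inr (.inl c))
    rcases v with x | x | x
    · have e1 := hg.2 (.inr (.inl b)) (.inl x) (by simp)
      have e2 := hg.2 (.inr (.inl b')) (.inl x) (by simp)
      rw [ha, hv] at e1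
      rw [ha', hv] at e2
      exact e1.trans ((not_congr (hbb x)).trans e2.symm)
    · obtain ⟨y, hy⟩ := h2 x
      rw [hv] at hy
      simp at hy
    · obtain ⟨y, hy⟩ := h3 x
      rw [hv] at hy
      simp at hy

end antimorphism

/-- A half-regular bipartite graph with distinct rows and, if `3 ≤ k`, two equal columns. -/
def twinColumns (k : ℕ) : Fin k ⊕ Fin k → Fin (k - 1) ⊕ Fin k ⊕ Unit → Prop
  | .inl _, .inl _ => True
  | .inl i, .inr (.inl j) => i = j
  | .inl _, .inr (.inr _) => False
  | .inr _, .inl _ => False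
  | .inr i, .inr (.inl j) => i ≠ j
  | .inr _, .inr (.inr _) => True

theorem halfRegular_twinColumns {k : ℕ} (hk : 1 ≤ k) : HalfRegular (twinColumns k) k := by
  have hsum : ∀ {α β : Type} [Fintype α] [Fintype β] (p : α ⊕ β → Prop),
      #{x | p x} = #{a | p (.inl a)} + #{b | p (.inr b)} := by
    intro α β _ _ p
    simp only [card_filter, Fintype.sum_sum_type]
  have hT : ∀ {α : Type} [Fintype α] {p : α → Prop}, (∀ a, p a) → #{a | p a} = Fintype.card α :=
    fun h => by rw [filter_true_of_mem fun a _ => h a, card_univ]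
  have hF : ∀ {α : Type} [Fintype α] {p : α → Prop}, (∀ a, ¬ p a) → #{a | p a} = 0 :=
    fun h => by rw [filter_false_of_mem fun a _ => h a, card_empty]
  have hE : ∀ (i : Fin k) {p : Fin k → Prop}, (∀ a, p a ↔ a = i) → #{a | p a} = 1 :=
    fun i {p} h => by rw [card_eq_one]; exact ⟨i, by ext a; simp [h]⟩
  have hN : ∀ (i : Fin k) {p : Fin k → Prop}, (∀ a, p a ↔ a ≠ i) → #{a | p a} = k - 1 := by
    intro i p h
    have : ({a | p a} : Finset (Fin k)) = univ.erase i := by ext a; simp [h]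
    rw [this, card_erase_of_mem (mem_univ i), card_univ, Fintype.card_fin]
  refine ⟨by simp; omega, by simp; omega, ?_, ?_⟩
  · rintro (i | i)
    · have h1 : #{a | twinColumns k (.inl i) (.inl a)} = _ := hT fun _ => trivial
      have h2 : #{a | twinColumns k (.inl i) (.inr (.inl a))} = _ := hE i fun _ => eq_comm
      have h3 : #{a | twinColumns k (.inl i) (.inr (.inr a))} = _ := hF fun _ h => h
      rw [hsum, hsum, h1, h2, h3, Fintype.card_fin]
      omega
    · have h1 : #{a | twinColumns k (.inr i) (.inl a)} = _ := hF fun _ h => h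
      have h2 : #{a | twinColumns k (.inr i) (.inr (.inl a))} = _ := hN i fun _ => ne_comm
      have h3 : #{a | twinColumns k (.inr i) (.inr (.inr a))} = _ := hT fun _ => trivial
      rw [hsum, hsum, h1, h2, h3, Fintype.card_unit]
      omega
  · rintro (i | i | i)
    · have h1 : #{a | twinColumns k (.inl a) (.inl i)} = _ := hT fun _ => trivial
      have h2 : #{a | twinColumns k (.inr a) (.inl i)} = _ := hF fun _ h => h
      rw [hsum, h1, h2, Fintype.card_fin, add_zero]
    · have h1 : #{a | twinColumns k (.inl a) (.inr (.inl i))} = _ := hE i fun _ => Iff.rfl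
      have h2 : #{a | twinColumns k (.inr a) (.inr (.inl i))} = _ := hN i fun _ => Iff.rfl
      rw [hsum, h1, h2]
      omega
    · have h1 : #{a | twinColumns k (.inl a) (.inr (.inr i))} = _ := hF fun _ h => h
      have h2 : #{a | twinColumns k (.inr a) (.inr (.inr i))} = _ := hT fun _ => trivial
      rw [hsum, h1, h2, Fintype.card_fin, zero_add]

/-- For k ≥ 3 the first block has at least two columns, all equal. Rows are pairwise distinct: the
first block separates the two kinds of rows, and the middle block separates rows of the same kind.
-/
theorem twinColumns_le_two {k : ℕ} (hk : 1 ≤ k) {W : Type} [Fintype W] {H : SimpleGraph W}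
    {g} (hg : IsAntimorphism (splitCompose (twinColumns k) H) g) : k ≤ 2 := by
  by_contra! hk3
  obtain ⟨a, a', hne, h⟩ := hg.exists_twin_rows (halfRegular_twinColumns hk) hk
    (b := .inl ⟨0, by omega⟩) (b' := .inl ⟨1, by omega⟩) (by simp)
    (by rintro (i | i) <;> exact Iff.rfl)
  have h0 := h (.inl ⟨0, by omega⟩)
  rcases a with i | i <;> rcases a' with j | j
  · exact hne (congrArg _ ((h (.inr (.inl i))).1 rfl).symm)
  · exact h0.1 trivial
  · exact h0.2 trivial
  · refine hne (congrArg _ ?_)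
    by_contra hij
    exact (h (.inr (.inl j))).1 hij rfl

end

/-! ### Exhaustive checks for small blocks. -/

/-- Pairs of permutations, one of which exchanges rows and columns of any half-regular `4 × 4`
matrix up to complementation. -/
def swapPairs : List ((Fin 4 → Fin 4) × (Fin 4 → Fin 4)) :=
  [(![0, 1, 2, 3], ![1, 0, 3, 2]), (![0, 1, 3, 2], ![1, 0, 2, 3]), (![0, 2, 1, 3], ![3, 1, 2, 0]),
   (![0, 3, 2, 1], ![2, 1, 0, 3]), (![0, 1, 2, 3], ![2, 3, 0, 1]), (![0, 1, 2, 3], ![3, 2, 1, 0]),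
   (![0, 1, 3, 2], ![2, 3, 1, 0]), (![0, 1, 3, 2], ![3, 2, 0, 1]), (![0, 2, 1, 3], ![1, 3, 0, 2]),
   (![0, 2, 1, 3], ![2, 0, 3, 1]), (![0, 2, 3, 1], ![1, 2, 0, 3]), (![0, 2, 3, 1], ![2, 1, 3, 0]),
   (![0, 2, 3, 1], ![3, 0, 2, 1]), (![0, 3, 1, 2], ![1, 3, 2, 0]), (![0, 3, 1, 2], ![2, 0, 1, 3]),
   (![0, 3, 1, 2], ![3, 1, 0, 2]), (![0, 3, 2, 1], ![1, 2, 3, 0]), (![0, 3, 2, 1], ![3, 0, 1, 2])]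

theorem swapPairs_injective : ∀ p ∈ swapPairs, p.1.Injective ∧ p.2.Injective := by
  simp only [swapPairs, List.forall_mem_cons]
  refine ⟨?_, ?_, ?_, ?_, ?_, ?_, ?_, ?_, ?_, ?_, ?_, ?_, ?_, ?_, ?_, ?_, ?_, ?_,
    fun _ h => absurd h List.not_mem_nil⟩ <;> exact ⟨by decide, by decide⟩

/-- Each row sum condition stands directly after the entries of its row, so the enumeration discards
bad rows before branching further. -/
theorem exists_swapPair_entries :
    ∀ a₀ a₁ a₂ a₃ : Bool, a₀.toNat + a₁.toNat + a₂.toNat + a₃.toNat = 2 →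
    ∀ b₀ b₁ b₂ b₃ : Bool, b₀.toNat + b₁.toNat + b₂.toNat + b₃.toNat = 2 →
    ∀ c₀ c₁ c₂ c₃ : Bool, c₀.toNat + c₁.toNat + c₂.toNat + c₃.toNat = 2 →
    ∀ d₀ d₁ d₂ d₃ : Bool, d₀.toNat + d₁.toNat + d₂.toNat + d₃.toNat = 2 →
    a₀.toNat + b₀.toNat + c₀.toNat + d₀.toNat = 2 → a₁.toNat + b₁.toNat + c₁.toNat + d₁.toNat = 2 →
    a₂.toNat + b₂.toNat + c₂.toNat + d₂.toNat = 2 → a₃.toNat + b₃.toNat + c₃.toNat + d₃.toNat = 2 →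
    ∃ p ∈ swapPairs, ∀ i j : Fin 4,
      (![![a₀, a₁, a₂, a₃], ![b₀, b₁, b₂, b₃], ![c₀, c₁, c₂, c₃], ![d₀, d₁, d₂, d₃]] :
        Fin 4 → Fin 4 → Bool) (p.2 j) (p.1 i) =
      !(![![a₀, a₁, a₂, a₃], ![b₀, b₁, b₂, b₃], ![c₀, c₁, c₂, c₃], ![d₀, d₁, d₂, d₃]] :
        Fin 4 → Fin 4 → Bool) i j := by
  decide +kernel

theorem exists_swap_four (M : Fin 4 → Fin 4 → Bool) (hr : ∀ i, ∑ j, (M i j).toNat = 2)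
    (hc : ∀ j, ∑ i, (M i j).toNat = 2) : ∃ s t : Fin 4 → Fin 4, s.Injective ∧ t.Injective ∧
      ∀ i j, M (t j) (s i) = !M i j := by
  simp only [Fin.sum_univ_four] at hr hc
  obtain ⟨p, hp, h⟩ := exists_swapPair_entries _ _ _ _ (hr 0) _ _ _ _ (hr 1) _ _ _ _ (hr 2)
    _ _ _ _ (hr 3) (hc 0) (hc 1) (hc 2) (hc 3)
  have hM : ![![M 0 0, M 0 1, M 0 2, M 0 3], ![M 1 0, M 1 1, M 1 2, M 1 3],
      ![M 2 0, M 2 1, M 2 2, M 2 3], ![M 3 0, M 3 1, M 3 2, M 3 3]] = M := by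
    funext i j
    fin_cases i <;> fin_cases j <;> rfl
  rw [hM] at h
  exact ⟨p.1, p.2, (swapPairs_injective p hp).1, (swapPairs_injective p hp).2, h⟩

theorem exists_swap_two (M : Fin 2 → Fin 2 → Bool) (hr : ∀ i, ∑ j, (M i j).toNat = 1)
    (hc : ∀ j, ∑ i, (M i j).toNat = 1) : ∃ s t : Fin 2 → Fin 2, s.Injective ∧ t.Injective ∧
      ∀ i j, M (t j) (s i) = !M i j := by
  refine ⟨![0, 1], ![1, 0], by decide, by decide, ?_⟩
  revert M
  decide +kernel

/-- The variables are the entries above the diagonal of the adjacency matrix. A 2-regular graph on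
five vertices is a 5-cycle; it suffices to try three permutations that fix vertex 0 and cycle the
other four. -/
theorem exists_antimorphism_entries :
    ∀ a b c d : Bool, a.toNat + b.toNat + c.toNat + d.toNat = 2 →
    ∀ e f g : Bool, a.toNat + e.toNat + f.toNat + g.toNat = 2 →
    ∀ h i : Bool, b.toNat + e.toNat + h.toNat + i.toNat = 2 →
    ∀ j : Bool, c.toNat + f.toNat + h.toNat + j.toNat = 2 →
    d.toNat + g.toNat + i.toNat + j.toNat = 2 →
    ∃ p ∈ ([![0, 2, 3, 4, 1], ![0, 2, 4, 1, 3], ![0, 3, 4, 2, 1]] : List (Fin 5 → Fin 5)),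
      ∀ u v : Fin 5, u ≠ v →
        (![![false, a, b, c, d], ![a, false, e, f, g], ![b, e, false, h, i],
          ![c, f, h, false, j], ![d, g, i, j, false]] : Fin 5 → Fin 5 → Bool) (p u) (p v) =
        !(![![false, a, b, c, d], ![a, false, e, f, g], ![b, e, false, h, i],
          ![c, f, h, false, j], ![d, g, i, j, false]] : Fin 5 → Fin 5 → Bool) u v := by
  decide +kernel

theorem exists_antimorphism_five (M : Fin 5 → Fin 5 → Bool) (h0 : ∀ i, M i i = false)
    (hs : ∀ i j, M i j = M j i) (hr : ∀ i, ∑ j, (M i j).toNat = 2) :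
    ∃ p : Fin 5 → Fin 5, p.Injective ∧ ∀ u v, u ≠ v → M (p u) (p v) = !M u v := by
  simp only [Fin.sum_univ_five] at hr
  obtain ⟨p, hp, h⟩ := exists_antimorphism_entries (M 0 1) (M 0 2) (M 0 3) (M 0 4)
    (by simpa [h0] using hr 0) (M 1 2) (M 1 3) (M 1 4) (by simpa [h0, hs 1 0] using hr 1)
    (M 2 3) (M 2 4) (by simpa [h0, hs 2 0, hs 2 1] using hr 2)
    (M 3 4) (by simpa [h0, hs 3 0, hs 3 1, hs 3 2] using hr 3)
    (by simpa [h0, hs 4 0, hs 4 1, hs 4 2, hs 4 3] using hr 4)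
  have hM : ![![false, M 0 1, M 0 2, M 0 3, M 0 4], ![M 0 1, false, M 1 2, M 1 3, M 1 4],
      ![M 0 2, M 1 2, false, M 2 3, M 2 4], ![M 0 3, M 1 3, M 2 3, false, M 3 4],
      ![M 0 4, M 1 4, M 2 4, M 3 4, false]] = M := by
    funext i j
    fin_cases i <;> fin_cases j <;> first | rfl | exact (h0 _).symm | exact hs _ _
  rw [hM] at h
  refine ⟨p, ?_, h⟩
  have : ∀ p ∈ ([![0, 2, 3, 4, 1], ![0, 2, 4, 1, 3], ![0, 3, 4, 2, 1]] : List (Fin 5 → Fin 5)),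
    p.Injective := by decide +kernel
  exact this p hp

section
open Finset Classical

theorem HalfRegular.exists_swap {α β : Type} [Fintype α] [Fintype β] {R : α → β → Prop} {k : ℕ}
    (hR : HalfRegular R k) (hk : k = 1 ∨ k = 2) :
    ∃ (s : α → β) (t : β → α), s.Injective ∧ t.Injective ∧ ∀ a b, R (t b) (s a) ↔ ¬ R a b := by
  let e := Fintype.equivFinOfCardEq hR.cardL
  let f := Fintype.equivFinOfCardEq hR.cardR
  let M : Fin (2 * k) → Fin (2 * k) → Bool := fun i j => decide (R (e.symm i) (f.symm j))
  have hr : ∀ i, ∑ j, (M i j).toNat = k := by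
    intro i
    refine Eq.trans ?_ (hR.row (e.symm i))
    rw [card_filter]
    refine Fintype.sum_equiv f.symm _ _ fun j => ?_
    by_cases h : R (e.symm i) (f.symm j) <;> simp [M, h]
  have hc : ∀ j, ∑ i, (M i j).toNat = k := by
    intro j
    refine Eq.trans ?_ (hR.col (f.symm j))
    rw [card_filter]
    refine Fintype.sum_equiv e.symm _ _ fun i => ?_
    by_cases h : R (e.symm i) (f.symm j) <;> simp [M, h]
  obtain ⟨s, t, hs, ht, h⟩ : ∃ s t : Fin (2 * k) → Fin (2 * k), s.Injective ∧ t.Injective ∧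
      ∀ i j, M (t j) (s i) = !M i j := by
    clear_value M
    clear e f hR
    rcases hk with rfl | rfl
    · exact exists_swap_two M hr hc
    · exact exists_swap_four M hr hc
  refine ⟨fun a => f.symm (s (e a)), fun b => e.symm (t (f b)),
    f.symm.injective.comp (hs.comp e.injective), e.symm.injective.comp (ht.comp f.injective),
    fun a b => ?_⟩
  have := h (e a) (f b)
  simp only [M, Equiv.symm_apply_apply] at this
  by_cases hab : R a b <;> simpa [hab] using this

theorem exists_antimorphism_of_five {V : Type} [Fintype V] {G : SimpleGraph V}
    (hV : Fintype.card V = 5) (hG : ∀ v, cnt G v univ = 2) : ∃ g, IsAntimorphism G g := by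
  let e := Fintype.equivFinOfCardEq hV
  let M : Fin 5 → Fin 5 → Bool := fun i j => decide (G.Adj (e.symm i) (e.symm j))
  obtain ⟨p, hp, h⟩ := exists_antimorphism_five M (fun i => by simp [M])
    (fun i j => by simp [M, G.adj_comm]) (fun i => by
      rw [← hG (e.symm i), cnt, card_filter]
      refine Fintype.sum_equiv e.symm _ _ fun j => ?_
      by_cases h : G.Adj (e.symm i) (e.symm j) <;> simp [M, h])
  refine ⟨fun v => e.symm (p (e v)), e.symm.injective.comp (hp.comp e.injective),
    fun u v huv => ?_⟩
  have := h (e u) (e v) (by simpa using huv)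
  simp only [M, Equiv.symm_apply_apply] at this
  by_cases hab : G.Adj u v <;> simpa [hab] using this

/-! ### Regular graphs that are not self-complementary. -/

/-- A `2k`-regular graph on `4k + 1` vertices with an independent set of size `2k` and chromatic
number at most three. -/
def unbalancedRegular (k : ℕ) :
    SimpleGraph ((Fin k × Bool) ⊕ (Fin k × Bool) ⊕ Unit) where
  Adj
    | .inl _, .inl _ => False
    | .inl i, .inr (.inl j) => i ≠ j
    | .inr (.inl j), .inl i => i ≠ j
    | .inl _, .inr (.inr _) => True
    | .inr (.inr _), .inl _ => True
    | .inr (.inl i), .inr (.inl j) => i.1 = j.1 ∧ i.2 ≠ j.2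
    | .inr (.inr _), .inr _ => False
    | .inr (.inl _), .inr (.inr _) => False
  symm := ⟨by
    rintro (a | b | w) (a' | b' | w') h <;> first | exact h | exact ⟨h.1.symm, h.2.symm⟩⟩
  loopless := ⟨by
    rintro (a | b | w) h
    · exact h
    · exact h.2 rfl
    · exact h⟩

theorem cnt_unbalancedRegular (k : ℕ) (v) : cnt (unbalancedRegular k) v univ = 2 * k := by
  have hT : ∀ {α : Type} [Fintype α] {p : α → Prop}, (∀ a, p a) → #{a | p a} = Fintype.card α :=
    fun h => by rw [filter_true_of_mem fun a _ => h a, card_univ]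
  have hF : ∀ {α : Type} [Fintype α] {p : α → Prop}, (∀ a, ¬ p a) → #{a | p a} = 0 :=
    fun h => by rw [filter_false_of_mem fun a _ => h a, card_empty]
  have hE : ∀ {α : Type} [Fintype α] (i : α) {p : α → Prop}, (∀ a, p a ↔ a = i) →
      #{a | p a} = 1 := by
    intro α _ i p h
    rw [card_eq_one]
    exact ⟨i, by ext a; simp [h]⟩
  have hN : ∀ (i : Fin k × Bool) {p : Fin k × Bool → Prop}, (∀ a, p a ↔ a ≠ i) →
      #{a | p a} = 2 * k - 1 := by
    intro i p h
    have : ({a | p a} : Finset (Fin k × Bool)) = univ.erase i := by ext a; simp [h]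
    rw [this, card_erase_of_mem (mem_univ i), card_univ, Fintype.card_prod, Fintype.card_fin,
      Fintype.card_bool, mul_comm]
  rw [cnt_sum_type]
  rcases v with i | i | i
  · have h1 : #{a | (unbalancedRegular k).Adj (.inl i) (.inl a)} = _ := hF fun _ h => h
    have h2 : #{a | (unbalancedRegular k).Adj (.inl i) (.inr (.inl a))} = _ :=
      hN i fun _ => ne_comm
    have h3 : #{a | (unbalancedRegular k).Adj (.inl i) (.inr (.inr a))} = _ :=
      hT fun _ => trivial
    have := i.1.pos
    rw [h1, h2, h3, Fintype.card_unit]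
    omega
  · have h1 : #{a | (unbalancedRegular k).Adj (.inr (.inl i)) (.inl a)} = _ :=
      hN i fun _ => Iff.rfl
    have h2 : #{a | (unbalancedRegular k).Adj (.inr (.inl i)) (.inr (.inl a))} = _ :=
      hE (i.1, !i.2) fun a => by
        obtain ⟨a, x⟩ := a
        obtain ⟨i, y⟩ := i
        simp only [unbalancedRegular, Prod.mk.injEq]
        cases x <;> cases y <;> simp [eq_comm]
    have h3 : #{a | (unbalancedRegular k).Adj (.inr (.inl i)) (.inr (.inr a))} = _ :=
      hF fun _ h => h
    have := i.1.pos
    rw [h1, h2, h3]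
    omega
  · have h1 : #{a | (unbalancedRegular k).Adj (.inr (.inr i)) (.inl a)} = _ :=
      hT fun _ => trivial
    have h2 : #{a | (unbalancedRegular k).Adj (.inr (.inr i)) (.inr (.inl a))} = _ :=
      hF fun _ h => h
    have h3 : #{a | (unbalancedRegular k).Adj (.inr (.inr i)) (.inr (.inr a))} = _ :=
      hF fun _ h => h
    rw [h1, h2, h3, Fintype.card_prod, Fintype.card_fin, Fintype.card_bool]
    omega

/-- An antimorphism would send four vertices of the independent set to a clique of size four, but
the graph is 3-colourable. -/
theorem not_isAntimorphism_unbalancedRegular {k : ℕ} (hk : 2 ≤ k) {g}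
    (hg : IsAntimorphism (unbalancedRegular k) g) : False := by
  let c : (Fin k × Bool) ⊕ (Fin k × Bool) ⊕ Unit → Fin 3 :=
    Sum.elim (fun _ => 0) (Sum.elim (fun j => if j.2 then 1 else 2) fun _ => 1)
  have hc : ∀ u v, (unbalancedRegular k).Adj u v → c u ≠ c v := by
    rintro (⟨i, x⟩ | ⟨i, x⟩ | i) (⟨j, y⟩ | ⟨j, y⟩ | j) h <;>
      simp only [unbalancedRegular] at h <;> simp only [c, Sum.elim_inl, Sum.elim_inr] <;>
      grind
  let q : Fin 2 × Bool → (Fin k × Bool) ⊕ (Fin k × Bool) ⊕ Unit :=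
    fun p => .inl (Fin.castLE hk p.1, p.2)
  have hq : q.Injective := by
    rintro ⟨i, x⟩ ⟨j, y⟩ h
    simpa [q] using h
  obtain ⟨u, v, huv, h⟩ := Fintype.exists_ne_map_eq_of_card_lt (fun p => c (g (q p))) (by simp)
  exact hc _ _ ((hg.2 (q u) (q v) (hq.ne huv)).2 fun h => h) h

end

/-! ### The recursion and the characterization. -/

section
open Finset Classical

/-- Swapping A and B maps the A-B edges bijectively to the A-B non-edges. -/
theorem IsAntimorphism.two_mul_edges {V : Type} [Fintype V] {G : SimpleGraph V} {g : V → V}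
    (hg : IsAntimorphism G g) {A B : Finset V} (hAB : Disjoint A B) (hA : A.image g = B)
    (hB : B.image g = A) : 2 * ∑ b ∈ B, cnt G b A = #A * #A := by
  have hcard : #B = #A := by rw [← hA, card_image_of_injective _ hg.1]
  have h1 : ∑ b ∈ B, cnt G b A = ∑ b ∈ B, cnt Gᶜ b A := by
    rw [sum_cnt_comm]
    conv_lhs => rw [← hB]
    rw [sum_image fun _ _ _ _ e => hg.1 e]
    refine sum_congr rfl fun b _ => ?_
    rw [← hg.cnt_image b A, hA]
  have h2 : ∑ b ∈ B, (cnt Gᶜ b A + cnt G b A) = ∑ b ∈ B, #A := by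
    refine sum_congr rfl fun b hb => ?_
    have := cnt_compl_graph G b A
    rw [if_neg (Finset.disjoint_right.1 hAB hb)] at this
    omega
  rw [sum_add_distrib, ← h1, sum_const, hcard, smul_eq_mul] at h2
  omega

/-- Every graph realizing the sequence admits an antimorphism. -/
def Forced (ℓ : ℕ) (d n : ℕ → ℕ) : Prop :=
  ∀ (V : Type) [Fintype V] (G : SimpleGraph V), Realizes G ℓ d n → ∃ g, IsAntimorphism G g

theorem Forced.extreme_terms {V : Type} [Fintype V] {G : SimpleGraph V} {ℓ : ℕ} {d n : ℕ → ℕ}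
    (hd : StrictAntiOn d (Set.Icc 1 (ℓ + 2))) (hn : ∀ i ∈ Set.Icc 1 (ℓ + 2), 1 ≤ n i)
    (hG : Realizes G (ℓ + 2) d n) (hF : Forced (ℓ + 2) d n) :
    ∃ k, 1 ≤ k ∧ n 1 = 2 * k ∧ n (ℓ + 2) = 2 * k ∧ d 1 + k + 1 = Fintype.card V ∧
      d (ℓ + 2) = k := by
  have i1 : 1 ∈ Set.Icc 1 (ℓ + 2) := ⟨le_rfl, by omega⟩
  have il : ℓ + 2 ∈ Set.Icc 1 (ℓ + 2) := ⟨by omega, le_rfl⟩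
  set f : V → ℕ := fun v => cnt G v univ with hf
  set A : Finset V := {v | f v = d 1} with hA
  set B : Finset V := {v | f v = d (ℓ + 2)} with hB
  have hlt : d (ℓ + 2) < d 1 := hd i1 il (by omega)
  have mA : ∀ v, v ∈ A ↔ f v = d 1 := fun v => by simp [hA]
  have mB : ∀ v, v ∈ B ↔ f v = d (ℓ + 2) := fun v => by simp [hB]
  have hAB : Disjoint A B := by
    rw [Finset.disjoint_left]
    intro v h1 h2
    rw [mA] at h1
    rw [mB] at h2
    omega
  have cA : #A = n 1 := hG.2 1 i1
  have cB : #B = n (ℓ + 2) := hG.2 _ il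
  have hub : ∀ v, f v ≤ d 1 := fun v => by
    obtain ⟨i, hi, e⟩ := hG.1 v
    exact e.trans_le (hd.antitoneOn i1 hi hi.1)
  have hlb : ∀ v, d (ℓ + 2) ≤ f v := fun v => by
    obtain ⟨i, hi, e⟩ := hG.1 v
    exact (hd.antitoneOn hi il hi.2).trans_eq e.symm
  obtain ⟨a, ha⟩ := card_pos.1 (cA ▸ hn 1 i1)
  obtain ⟨b, hb⟩ := card_pos.1 (cB ▸ hn _ il)
  obtain ⟨g, hg⟩ := hF V G hG
  -- The image of a has at least the minimum degree and the image of b at most the maximum; the two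
  -- inequalities give equality.
  have hN : d 1 + d (ℓ + 2) + 1 = Fintype.card V := by
    have h1 : f (g a) + f a + 1 = _ := hg.cnt_univ a
    have h2 : f (g b) + f b + 1 = _ := hg.cnt_univ b
    have := hlb (g a)
    have := hub (g b)
    rw [(mA a).1 ha] at h1
    rw [(mB b).1 hb] at h2
    omega
  have himg : ∀ G' : SimpleGraph V, (∀ v, cnt G' v univ = f v) → ∀ g', IsAntimorphism G' g' →
      A.image g' = B ∧ B.image g' = A := by
    intro G' hG' g' hg'
    have hs := hg'.cnt_univ
    simp only [hG'] at hs
    have s1 : A.image g' ⊆ B := by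
      intro x hx
      obtain ⟨v, hv, rfl⟩ := mem_image.1 hx
      rw [mA] at hv
      rw [mB]
      have := hs v
      omega
    have s2 : B.image g' ⊆ A := by
      intro x hx
      obtain ⟨v, hv, rfl⟩ := mem_image.1 hx
      rw [mB] at hv
      rw [mA]
      have := hs v
      omega
    have c1 := card_le_card s1
    have c2 := card_le_card s2
    rw [card_image_of_injective _ hg'.1] at c1 c2
    exact ⟨eq_of_subset_of_card_le s1 (by rw [card_image_of_injective _ hg'.1]; omega),
      eq_of_subset_of_card_le s2 (by rw [card_image_of_injective _ hg'.1]; omega)⟩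
  obtain ⟨gA, gB⟩ := himg G (fun _ => rfl) g hg
  have hcard : #B = #A := by rw [← gA, card_image_of_injective _ hg.1]
  have hedge := hg.two_mul_edges hAB gA gB
  obtain ⟨k, hk⟩ : Even #A := by
    have : Even (#A * #A) := ⟨_, by rw [← hedge, two_mul]⟩
    simpa [Nat.even_mul] using this
  have hApos : 0 < #A := card_pos.2 ⟨a, ha⟩
  have F : Frame f A B k :=
    { disj := hAB
      cardA := by omega
      cardB := by omega
      pos := by omega
      lt_card := fun v => by have := hub v; omega
      constA := fun v hv w hw => by rw [(mA v).1 hv, (mA w).1 hw]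
      constB := fun v hv w hw => by rw [(mB v).1 hv, (mB w).1 hw]
      topA := fun v hv w hw => by
        rw [(mA v).1 hv]
        rw [mA] at hw
        exact lt_of_le_of_ne (hub w) hw
      botB := fun v hv w hw => by
        rw [(mB v).1 hv]
        rw [mB] at hw
        exact lt_of_le_of_ne (hlb w) (Ne.symm hw)
      edges := fun G' hG' => by
        have hR : Realizes G' (ℓ + 2) d n := by
          unfold Realizes
          simp only [hG']
          exact hG
        obtain ⟨g', hg'⟩ := hF V G' hR
        obtain ⟨e1, e2⟩ := himg G' hG' g' hg'
        have := hg'.two_mul_edges hAB e1 e2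
        rw [hk] at this
        nlinarith }
  refine ⟨k, by omega, by omega, by omega, ?_⟩
  rcases F.degree_eq G (fun _ => rfl) with h | h
  · have := h a ha
    rw [(mA a).1 ha] at this
    omega
  · have := h b hb
    rw [(mB b).1 hb] at this
    omega

theorem sum_Icc_one_succ {M : Type*} [AddCommMonoid M] (n : ℕ → M) (ℓ : ℕ) :
    ∑ i ∈ Icc 1 (ℓ + 1), n i = n 1 + ∑ i ∈ Icc 1 ℓ, n (i + 1) := by
  induction ℓ with
  | zero => simp
  | succ ℓ ih =>
    rw [sum_Icc_succ_top (by omega), ih, sum_Icc_succ_top (by omega), add_assoc]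

/-- The numerical conditions of the characterization. -/
def RaoConditions (ℓ : ℕ) (d n : ℕ → ℕ) (N : ℕ) : Prop :=
  (∀ i ∈ Set.Icc 1 (ℓ / 2),
    n (ℓ + 1 - i) = n i ∧ (n i = 2 ∨ n i = 4) ∧
    (d (ℓ + 1 - i) : ℚ) = (N : ℚ) - 1 - (d i : ℚ) ∧
    (N : ℚ) - 1 - (d i : ℚ) = (∑ j ∈ Finset.Icc 1 i, (n j : ℚ)) - (n i : ℚ) / 2) ∧
  (Odd ℓ →
    (n ((ℓ + 1) / 2) = 1 ∨ n ((ℓ + 1) / 2) = 5) ∧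
    (d ((ℓ + 1) / 2) : ℚ) = ((N : ℚ) - 1) / 2)

theorem RaoConditions.extreme_terms {ℓ : ℕ} {d n : ℕ → ℕ} {N : ℕ}
    (h : RaoConditions (ℓ + 2) d n N) :
    ∃ k, 1 ≤ k ∧ n 1 = 2 * k ∧ n (ℓ + 2) = 2 * k ∧ d 1 + k + 1 = N ∧ d (ℓ + 2) = k := by
  obtain ⟨h1, h2, h3, h4⟩ := h.1 1 ⟨le_rfl, by omega⟩
  simp only [Nat.add_sub_cancel, Icc_self, sum_singleton] at h1 h3 h4
  obtain ⟨k, hk, hk1⟩ : ∃ k, n 1 = 2 * k ∧ 1 ≤ k := by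
    rcases h2 with h2 | h2
    · exact ⟨1, by omega, by omega⟩
    · exact ⟨2, by omega, by omega⟩
  rw [hk] at h4
  push_cast at h4
  refine ⟨k, hk1, hk, h1.trans hk, ?_, ?_⟩
  · have : ((d 1 + k + 1 : ℕ) : ℚ) = N := by push_cast; linarith
    exact_mod_cast this
  · have : ((d (ℓ + 2) : ℕ) : ℚ) = k := by linarith
    exact_mod_cast this

/-- Peeling lowers the order by 4k, every middle degree by 2k and every partial sum by n 1 = 2k, so
the two sides of each condition change by the same amount. -/
theorem raoConditions_add_two {ℓ k : ℕ} {d n : ℕ → ℕ} {N : ℕ}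
    (n1 : n 1 = 2 * k) (nl : n (ℓ + 2) = 2 * k) (d1 : d 1 + k + 1 = N + 4 * k)
    (dl : d (ℓ + 2) = k) (hge : ∀ i ∈ Set.Icc 1 ℓ, 2 * k ≤ d (i + 1)) :
    RaoConditions (ℓ + 2) d n (N + 4 * k) ↔ (k = 1 ∨ k = 2) ∧
      RaoConditions ℓ (fun i => d (i + 1) - 2 * k) (fun i => n (i + 1)) N := by
  have cast : ∀ i ∈ Set.Icc 1 ℓ, ((d (i + 1) - 2 * k : ℕ) : ℚ) = d (i + 1) - 2 * k := by
    intro i hi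
    rw [Nat.cast_sub (hge i hi)]
    push_cast
    rfl
  have d1' : (d 1 : ℚ) + k + 1 = N + 4 * k := by exact_mod_cast d1
  have hmid : ∀ i ∈ Set.Icc 1 (ℓ / 2),
      ((n (ℓ + 2 + 1 - (i + 1)) = n (i + 1) ∧ (n (i + 1) = 2 ∨ n (i + 1) = 4) ∧
        (d (ℓ + 2 + 1 - (i + 1)) : ℚ) = ((N + 4 * k : ℕ) : ℚ) - 1 - (d (i + 1) : ℚ) ∧
        ((N + 4 * k : ℕ) : ℚ) - 1 - (d (i + 1) : ℚ) =
          (∑ j ∈ Finset.Icc 1 (i + 1), (n j : ℚ)) - (n (i + 1) : ℚ) / 2) ↔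
      (n (ℓ + 1 - i + 1) = n (i + 1) ∧ (n (i + 1) = 2 ∨ n (i + 1) = 4) ∧
        ((d (ℓ + 1 - i + 1) - 2 * k : ℕ) : ℚ) = (N : ℚ) - 1 - ((d (i + 1) - 2 * k : ℕ) : ℚ) ∧
        (N : ℚ) - 1 - ((d (i + 1) - 2 * k : ℕ) : ℚ) =
          (∑ j ∈ Finset.Icc 1 i, (n (j + 1) : ℚ)) - (n (i + 1) : ℚ) / 2)) := by
    intro i hi
    have h1 := hi.1
    have h2 := hi.2
    have e : ℓ + 2 + 1 - (i + 1) = ℓ + 1 - i + 1 := by omega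
    rw [e, cast i ⟨h1, by omega⟩, cast (ℓ + 1 - i) ⟨by omega, by omega⟩,
      sum_Icc_one_succ (fun j => (n j : ℚ)), n1]
    push_cast
    refine and_congr_right fun _ => and_congr_right fun _ => and_congr ?_ ?_
    · constructor <;> intro h <;> linarith
    · constructor <;> intro h <;> linarith
  have hodd : (Odd (ℓ + 2) → (n ((ℓ + 2 + 1) / 2) = 1 ∨ n ((ℓ + 2 + 1) / 2) = 5) ∧
        (d ((ℓ + 2 + 1) / 2) : ℚ) = (((N + 4 * k : ℕ) : ℚ) - 1) / 2) ↔
      (Odd ℓ → (n ((ℓ + 1) / 2 + 1) = 1 ∨ n ((ℓ + 1) / 2 + 1) = 5) ∧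
        ((d ((ℓ + 1) / 2 + 1) - 2 * k : ℕ) : ℚ) = ((N : ℚ) - 1) / 2) := by
    have e : (ℓ + 2 + 1) / 2 = (ℓ + 1) / 2 + 1 := by omega
    have ho : Odd (ℓ + 2) ↔ Odd ℓ := by simp [Nat.odd_add]
    rw [e, ho]
    refine imp_congr_right fun ⟨m, hm⟩ => and_congr_right fun _ => ?_
    rw [cast _ ⟨by omega, by omega⟩]
    push_cast
    constructor <;> intro h <;> linarith
  unfold RaoConditions
  rw [hodd]
  constructor
  · rintro ⟨h1, h2⟩
    refine ⟨?_, fun i hi => (hmid i hi).1 (h1 _ ⟨by omega, by have := hi.2; omega⟩), h2⟩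
    have := (h1 1 ⟨le_rfl, by omega⟩).2.1
    omega
  · rintro ⟨hk, h1, h2⟩
    refine ⟨fun i hi => ?_, h2⟩
    have hi1 := hi.1
    have hi2 := hi.2
    by_cases h : i = 1
    · subst h
      simp only [Nat.add_sub_cancel, Icc_self, sum_singleton, n1, nl, dl]
      push_cast
      exact ⟨trivial, by omega, by linarith, by linarith⟩
    · obtain ⟨j, rfl⟩ : ∃ j, i = j + 1 := ⟨i - 1, by omega⟩
      have hj : j ∈ Set.Icc 1 (ℓ / 2) := ⟨by omega, by omega⟩
      exact (hmid j hj).2 (h1 j hj)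

/-- Forward, every inner realization H is composed with `twinColumns`, which bounds k and hands an
antimorphism down to H. Backward, an antimorphism of H is combined with a row-column swap of R. The
realization G supplies at least one H for the bound on k. -/
theorem forced_add_two {V : Type} [Fintype V] {G : SimpleGraph V} {ℓ k : ℕ} {d n : ℕ → ℕ} {N : ℕ}
    (hd : StrictAntiOn d (Set.Icc 1 (ℓ + 2))) (hn : ∀ i ∈ Set.Icc 1 (ℓ + 2), 1 ≤ n i)
    (hG : Realizes G (ℓ + 2) d n) (hk : 1 ≤ k) (n1 : n 1 = 2 * k) (nl : n (ℓ + 2) = 2 * k)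
    (d1 : d 1 + k + 1 = N + 4 * k) (dl : d (ℓ + 2) = k)
    (hN : N = ∑ i ∈ Icc 1 ℓ, n (i + 1))
    (hd' : StrictAntiOn (fun i => d (i + 1) - 2 * k) (Set.Icc 1 ℓ))
    (hge : ∀ i ∈ Set.Icc 1 ℓ, 2 * k ≤ d (i + 1))
    (hcard : ∀ (V : Type) [Fintype V] (G : SimpleGraph V), Realizes G (ℓ + 2) d n →
      Fintype.card V = N + 4 * k) :
    Forced (ℓ + 2) d n ↔ (k = 1 ∨ k = 2) ∧
      Forced ℓ (fun i => d (i + 1) - 2 * k) (fun i => n (i + 1)) := by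
  constructor
  · intro hF
    have hcomp : ∀ (W : Type) [Fintype W] (H : SimpleGraph W),
        Realizes H ℓ (fun i => d (i + 1) - 2 * k) (fun i => n (i + 1)) →
        ∃ g, IsAntimorphism (splitCompose (twinColumns k) H) g := by
      intro W _ H hH
      refine hF _ _ (Realizes.splitCompose (halfRegular_twinColumns hk) hk hd n1 nl ?_ dl hge hH)
      rw [hH.card_eq hd', ← hN]
      omega
    refine ⟨?_, fun W _ H hH => ?_⟩
    · obtain ⟨-, -, W, -, -, _, -, H, -, -, hH, -⟩ :=
        hG.exists_splitCompose hd hn n1 nl (by rw [hcard V G hG]; exact d1) dl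
      obtain ⟨g, hg⟩ := hcomp W H hH
      have := twinColumns_le_two hk hg
      omega
    · obtain ⟨g, hg⟩ := hcomp W H hH
      exact hg.of_splitCompose (halfRegular_twinColumns hk) hk
  · rintro ⟨hk2, hF⟩ V _ G hG
    obtain ⟨α, β, W, _, _, _, R, H, hR, ⟨e⟩, hH, -⟩ :=
      hG.exists_splitCompose hd hn n1 nl (by rw [hcard V G hG]; exact d1) dl
    obtain ⟨g, hg⟩ := hF W H hH
    obtain ⟨s, t, hs, ht, hst⟩ := hR.exists_swap hk2
    rw [← isSelfComplementary_iff]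
    exact IsSelfComplementary.of_iso e ((isSelfComplementary_iff _).2
      (splitCompose_isAntimorphism R H hg hs ht hst))

theorem forced_one_iff {V : Type} [Fintype V] {G : SimpleGraph V} {d n : ℕ → ℕ}
    (hn : 1 ≤ n 1) (hG : Realizes G 1 d n) :
    Forced 1 d n ↔ RaoConditions 1 d n (n 1) := by
  have i1 : 1 ∈ Set.Icc 1 1 := ⟨le_rfl, le_rfl⟩
  have hreal : ∀ (V : Type) [Fintype V] (G : SimpleGraph V), Realizes G 1 d n ↔
      (∀ v, cnt G v univ = d 1) ∧ Fintype.card V = n 1 := by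
    intro V _ G
    have hone : ∀ i ∈ Set.Icc 1 1, i = 1 := fun i hi => le_antisymm hi.2 hi.1
    constructor
    · intro h
      have hdeg : ∀ v, cnt G v univ = d 1 := fun v => by
        obtain ⟨i, hi, e⟩ := h.1 v
        rwa [hone i hi] at e
      refine ⟨hdeg, ?_⟩
      rw [← h.2 1 i1, filter_true_of_mem fun v _ => hdeg v, card_univ]
    · rintro ⟨h1, h2⟩
      refine ⟨fun v => ⟨1, i1, h1 v⟩, fun i hi => ?_⟩
      rw [hone i hi, filter_true_of_mem fun v _ => h1 v, card_univ, h2]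
  have hrao : RaoConditions 1 d n (n 1) ↔ (n 1 = 1 ∨ n 1 = 5) ∧ n 1 = 2 * d 1 + 1 := by
    have : (d 1 : ℚ) = ((n 1 : ℚ) - 1) / 2 ↔ n 1 = 2 * d 1 + 1 := by
      rw [← Nat.cast_inj (R := ℚ)]
      push_cast
      constructor <;> intro h <;> linarith
    simp [RaoConditions, this]
  rw [hrao]
  obtain ⟨hdeg, hcard⟩ := (hreal V G).1 hG
  constructor
  · intro hF
    obtain ⟨g, hg⟩ := hF V G hG
    have hV : 0 < Fintype.card V := by omega
    obtain ⟨v⟩ := Fintype.card_pos_iff.1 hV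
    have hs := hg.cnt_univ v
    rw [hdeg, hdeg, hcard] at hs
    have hsum := G.sum_degrees_eq_twice_card_edges
    simp only [← cnt_univ, hdeg, sum_const, card_univ, hcard, smul_eq_mul] at hsum
    -- The order is 2 d 1 + 1, hence odd, so the handshake lemma makes the degree even.
    have heven : Even (d 1) := by
      have : Even (n 1 * d 1) := ⟨_, by rw [hsum, two_mul]⟩
      rw [Nat.even_mul] at this
      rcases this with h | h
      · rw [← hs] at h
        exact absurd h (by rw [Nat.not_even_iff_odd]; exact ⟨d 1, by ring⟩)
      · exact h
    obtain ⟨k, hk⟩ := heven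
    have hk2 : k < 2 := by
      by_contra! hk2
      obtain ⟨g', hg'⟩ := hF _ (unbalancedRegular k) ((hreal _ _).2
        ⟨fun v => by rw [cnt_unbalancedRegular]; omega, by simp; omega⟩)
      exact not_isAntimorphism_unbalancedRegular hk2 hg'
    omega
  · rintro ⟨h1 | h1, h2⟩ V _ G hG
    · obtain ⟨hdeg, hcard⟩ := (hreal V G).1 hG
      rw [h1] at hcard
      have := Fintype.card_le_one_iff.1 hcard.le
      exact ⟨id, Function.injective_id, fun u v huv => absurd (this u v) huv⟩
    · obtain ⟨hdeg, hcard⟩ := (hreal V G).1 hG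
      exact exists_antimorphism_of_five (hcard.trans h1) fun v => by rw [hdeg]; omega

theorem forced_iff (ℓ : ℕ) : ∀ (d n : ℕ → ℕ), StrictAntiOn d (Set.Icc 1 ℓ) →
    (∀ i ∈ Set.Icc 1 ℓ, 1 ≤ n i) →
    (∃ (V : Type) (_ : Fintype V) (G : SimpleGraph V), Realizes G ℓ d n) →
    (Forced ℓ d n ↔ RaoConditions ℓ d n (∑ i ∈ Icc 1 ℓ, n i)) := by
  induction ℓ using Nat.twoStepInduction with
  | zero =>
    rintro d n - - -
    refine iff_of_true ?_ ?_
    · intro V _ G hG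
      have : IsEmpty V := ⟨fun v => by
        obtain ⟨i, hi, -⟩ := hG.1 v
        have := hi.1
        have := hi.2
        omega⟩
      exact ⟨id, Function.injective_id, fun u => isEmptyElim u⟩
    · simp [RaoConditions]
  | one =>
    rintro d n - hn ⟨V, _, G, hG⟩
    simpa using forced_one_iff (hn 1 ⟨le_rfl, le_rfl⟩) hG
  | more ℓ ih _ =>
    rintro d n hd hn ⟨V, _, G, hG⟩
    have hsum : ∑ i ∈ Icc 1 (ℓ + 2), n i = n 1 + ∑ i ∈ Icc 1 ℓ, n (i + 1) + n (ℓ + 2) := by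
      rw [sum_Icc_succ_top (by omega), sum_Icc_one_succ]
    -- Both sides of the equivalence imply these values of the extreme terms, so it is enough to
    -- prove it under them.
    have key : ∀ k, 1 ≤ k → n 1 = 2 * k → n (ℓ + 2) = 2 * k →
        d 1 + k + 1 = ∑ i ∈ Icc 1 (ℓ + 2), n i → d (ℓ + 2) = k →
        (Forced (ℓ + 2) d n ↔ RaoConditions (ℓ + 2) d n (∑ i ∈ Icc 1 (ℓ + 2), n i)) := by
      intro k hk n1 nl d1 dl
      obtain ⟨-, -, W, -, -, _, -, H, -, -, hH, hge⟩ :=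
        hG.exists_splitCompose hd hn n1 nl (by rw [hG.card_eq hd]; exact d1) dl
      have hd' : StrictAntiOn (fun i => d (i + 1) - 2 * k) (Set.Icc 1 ℓ) := by
        intro i hi j hj hij
        have h1 := hge i hi
        have h2 := hge j hj
        have := hd (⟨by omega, by have := hi.2; omega⟩ : i + 1 ∈ Set.Icc 1 (ℓ + 2))
          (⟨by omega, by have := hj.2; omega⟩ : j + 1 ∈ Set.Icc 1 (ℓ + 2)) (by omega)
        simp only
        omega
      have hN : ∑ i ∈ Icc 1 (ℓ + 2), n i = ∑ i ∈ Icc 1 ℓ, n (i + 1) + 4 * k := by omega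
      rw [hN] at d1 ⊢
      rw [raoConditions_add_two n1 nl d1 dl hge,
        forced_add_two hd hn hG hk n1 nl d1 dl rfl hd' hge
          (fun V _ G h => (h.card_eq hd).trans hN),
        ih _ _ hd' (fun i hi => hn _ ⟨by omega, by have := hi.2; omega⟩) ⟨W, _, H, hH⟩]
    constructor
    · intro hF
      obtain ⟨k, hk, n1, nl, d1, dl⟩ := hF.extreme_terms hd hn hG
      exact (key k hk n1 nl (d1.trans (hG.card_eq hd)) dl).1 hF
    · intro hR
      obtain ⟨k, hk, n1, nl, d1, dl⟩ := hR.extreme_terms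
      exact (key k hk n1 nl d1 dl).2 hR

end

theorem mainTheorem2 (ℓ : ℕ) (d n : ℕ → ℕ)
    (hd : StrictAntiOn d (Set.Icc 1 ℓ))
    (hn : ∀ i ∈ Set.Icc 1 ℓ, 1 ≤ n i)
    (hseq : IsDegreeSequence (compactSequence ℓ d n))
    (N : ℕ) (hN : N = ∑ i ∈ Finset.Icc 1 ℓ, n i) :
    IsForciblySelfComplementary (compactSequence ℓ d n) ↔
      (∀ i ∈ Set.Icc 1 (ℓ / 2),
        n (ℓ + 1 - i) = n i ∧ (n i = 2 ∨ n i = 4) ∧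
        (d (ℓ + 1 - i) : ℚ) = (N : ℚ) - 1 - (d i : ℚ) ∧
        (N : ℚ) - 1 - (d i : ℚ) = (∑ j ∈ Finset.Icc 1 i, (n j : ℚ)) - (n i : ℚ) / 2) ∧
      (Odd ℓ →
        (n ((ℓ + 1) / 2) = 1 ∨ n ((ℓ + 1) / 2) = 5) ∧
        (d ((ℓ + 1) / 2) : ℚ) = ((N : ℚ) - 1) / 2) := by
  subst hN
  obtain ⟨V, hV, G, hG⟩ := hseq
  refine Iff.trans ?_ (forced_iff ℓ d n hd hn ⟨V, hV, G, (degreeSequence_eq_iff G ℓ d n hd).1 hG⟩)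
  constructor
  · intro h V _ G hG
    exact (isSelfComplementary_iff G).1 (h V G ((degreeSequence_eq_iff G ℓ d n hd).2 hG))
  · intro h V _ G hG
    exact (isSelfComplementary_iff G).2 (h V G ((degreeSequence_eq_iff G ℓ d n hd).1 hG))
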